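/- **Setting.** Frequencies $\lambda$ lie in $[-\pi,\pi)$. A *spectral density* is an integrable, a.e. nonnegative function on $[-\pi,\pi)$; equalities of densities are a.e. Let $(a(k))_{k\ge 0}$ be complex numbers with $\sum_k|a(k)|<\infty$ and $\sum_k (k+1)|a(k)|^2<\infty$, and put $A(e^{i\lambda})=\sum_{k\ge0}a(k)e^{-i\lambda k}$. Let $\xi,\eta$ be uncorrelated stationary sequences with spectral densities $f,g$. The functional $A\xi=\sum_{k\ge0}a(k)\xi(-k)$ is estimated from the observations $\xi(m)+\eta(m)$, $m\le 0$, by $\int h\,dZ_{\xi+\eta}$, where $Z_{\xi+\eta}$ is the orthogonal random measure in the spectral representation of $\xi+\eta$ and $h\in L_2^0(f+g)$, the closed linear span of $\{e^{im\lambda}:m\le 0\}$ in $L_2(f+g)$. The mean-square error is $$\Delta(h;f,g)=\frac1{2\pi}\int_{-\pi}^{\pi}|A(e^{i\lambda})-h(\lambda)|^2f(\lambda)\,d\lambda+\frac1{2\pi}\int_{-\pi}^{\pi}|h(\lambda)|^2g(\lambda)\,d\lambda ,$$ and $\Delta(f,g)=\inf_{h\in L_2^0(f+g)}\Delta(h;f,g)$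 is the error of the optimal estimate. The pair $(f,g)$ satisfies the *minimality condition* if $\int_{-\pi}^{\pi}\frac{d\lambda}{f(\lambda)+g(\lambda)}<\infty$. For $(f,g)$ satisfying minimality let, for $k,j\ge0$, $$P_{k,j}=\frac1{2\pi}\int_{-\pi}^{\pi}\frac{e^{i\lambda(j-k)}}{f+g}\,d\lambda,\quad R_{k,j}=\frac1{2\pi}\int_{-\pi}^{\pi}\frac{e^{-i\lambda(j+k)}f}{f+g}\,d\lambda,\quad Q_{k,j}=\frac1{2\pi}\int_{-\pi}^{\pi}\frac{e^{i\lambda(k-j)}fg}{f+g}\,d\lambda,$$ $(\mathbf R\mathbf a)_l=\sum_{m}R_{l+1,m}a(m)$, $(\mathbf P x)_l=\sum_k P_{l+1,k+1}x_k$, $(\mathbf Q\mathbf a)_l=\sum_kQ_{l,k}a(k)$, and $\langle x,y\rangle=\sum_l x_l\overline{y_l}$. As $1/(f+g)$ need not be bounded, $\mathbf P$ and $\mathbf P^{-1}$ are understood in the energy norm: the statement that $c=\mathbf P^{-1}b$ and $C(\lambda)=\sum_{k\ge0}c_ke^{i\lambda(k+1)}$ means that there are finitely supported vectors $x^{(n)}$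 with $$\int_{-\pi}^{\pi}\frac{\bigl|C(\lambda)-\sum_kx^{(n)}_ke^{i\lambda(k+1)}\bigr|^2}{f(\lambda)+g(\lambda)}\,d\lambda\to0\quad\text{and}\quad(\mathbf Px^{(n)})_l\to b_l\ \text{ for every } l,$$ and then $\langle b,\mathbf P^{-1}b\rangle=\lim_n\langle b,x^{(n)}\rangle$. (For $f+g$ bounded and bounded away from $0$, $\mathbf P^{-1}$ is the usual bounded inverse on $\ell_2$.) Put $$C_{f,g}(\lambda)=\sum_{k\ge0}(\mathbf P^{-1}\mathbf R\mathbf a)_ke^{i\lambda(k+1)},\qquad h(f,g)=\frac{A(e^{i\lambda})f-C_{f,g}}{f+g},\qquad h_g(f,g)=\frac{|A(e^{i\lambda})f-C_{f,g}|}{f+g}.$$ Let $0\le\varepsilon\le1$, let $P_2$ be a real number, $g_1$ a spectral density, and let $\mathcal D_\varepsilon$ be the class of spectral densities $g$ of the form $g=(1-\varepsilon)g_1+\varepsilon w$ with $w$ a spectral density and $\frac1{2\pi}\int_{-\pi}^{\pi}g\,d\lambda\le P_2$. **Theorem.** Let the spectral density $f$ be known and let $g^0\in\mathcal D_\varepsilon$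 be such that $(f,g^0)$ satisfies the minimality condition and $h_g(f,g^0)$ is (essentially) bounded. Suppose that, for some real constant $\alpha_2$, for a.e. $\lambda$, $$g^0(\lambda)=\max\bigl\{(1-\varepsilon)g_1(\lambda),\ \alpha_2\,|A(e^{i\lambda})f(\lambda)-C_{f,g^0}(\lambda)|-f(\lambda)\bigr\},$$ and that $(f,g^0)$ solves the extremal problem: the functional $$\langle\mathbf R\mathbf a,\mathbf P^{-1}\mathbf R\mathbf a\rangle+\langle\mathbf Q\mathbf a,\mathbf a\rangle$$ formed with $(f,g)$, where $g$ ranges over all $g\in\mathcal D_\varepsilon$ such that $(f,g)$ satisfies minimality, attains its maximum at $g=g^0$. Then: 1. $g^0$ is least favorable in $\mathcal D_\varepsilon$: $\Delta(f,g)\le\Delta(f,g^0)$ for all $g\in\mathcal D_\varepsilon$. 2. $h(f,g^0)$ is minimax-robust: it belongs to $H_{\mathcal D}=\bigcap_{g\in\mathcal D_\varepsilon}L_2^0(f+g)$ and $$\sup_{g\in\mathcal D_\varepsilon}\Delta(h(f,g^0);f,g)=\min_{h\in H_{\mathcal D}}\ \sup_{g\in\mathcal D_\varepsilon}\Delta(h;f,g).$$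 -/

import Mathlib

open MeasureTheory Filter Topology Real AddCircle

noncomputable section

namespace RobustFiltering

instance factTwoPiPos : Fact (0 < 2 * π) := ⟨Real.two_pi_pos⟩

/-- The frequency circle `[-π, π)`. A function on it is a `2π`-periodic function of the frequency,
`fourier n t = e^{int}`, and integration against `haarAddCircle` is `(1 / 2π) ∫_{-π}^{π} … dt`. -/
abbrev Freq : Type := AddCircle (2 * π)

/-- A spectral density (a density of an absolutely continuous spectral function). -/
def IsSpectralDensity (f : Freq → ℝ) : Prop :=
  Integrable f haarAddCircle ∧ ∀ᵐ t ∂haarAddCircle, 0 ≤ f t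

/-- The measure `(1 / 2π) p(t) dt`; its `L²` space is the paper's `L₂(p)`. -/
def weight (p : Freq → ℝ) : Measure Freq :=
  haarAddCircle.withDensity fun t => ENNReal.ofReal (p t)

/-- The minimality condition `∫ 1 / (f + g) < ∞` (the integrand is `∞` where `f + g = 0`). -/
def Minimality (f g : Freq → ℝ) : Prop :=
  ∫⁻ t, (ENNReal.ofReal (f t + g t))⁻¹ ∂haarAddCircle < ⊤

/-- `A(e^{it}) = ∑_{k ≥ 0} a(k) e^{-ikt}`, the spectral form of `Aξ = ∑_{k ≥ 0} a(k) ξ(-k)`. -/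
def symbolA (a : ℕ → ℂ) (t : Freq) : ℂ :=
  ∑' k : ℕ, a k * fourier (-(k : ℤ)) t

/-- `h ∈ L₂⁰(p)`: `h` is in the closure in `L₂(p)` of the linear span of `e^{imt}`, `m ≤ 0`. -/
def InPastSpace (p : Freq → ℝ) (h : Freq → ℂ) : Prop :=
  MemLp h 2 (weight p) ∧ ∀ δ : ENNReal, 0 < δ → ∃ x : ℕ →₀ ℂ,
    eLpNorm (fun t => h t - x.sum fun m z => z * fourier (-(m : ℤ)) t) 2 (weight p) < δ

/-- `Δ(h; f, g)`: the mean-square error `E |Aξ - Âξ|²` of the estimate `Âξ = ∫ h dZ_{ξ+η}` of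
`Aξ = ∫ A dZ_ξ`, where `ξ`, `η` are uncorrelated with spectral densities `f`, `g`; that is
`(1 / 2π) ∫ |A - h|² f + (1 / 2π) ∫ |h|² g`. -/
def meanSquareError (a : ℕ → ℂ) (h : Freq → ℂ) (f g : Freq → ℝ) : ENNReal :=
  (∫⁻ t, ‖symbolA a t - h t‖ₑ ^ 2 ∂weight f) + ∫⁻ t, ‖h t‖ₑ ^ 2 ∂weight g

/-- `Δ(f, g)`: the mean-square error of the optimal linear estimate of `Aξ` from the observations
`ξ(m) + η(m)`, `m ≤ 0`, i.e. the squared distance from `Aξ` to their closed linear span. -/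
def optimalError (a : ℕ → ℂ) (f g : Freq → ℝ) : ENNReal :=
  ⨅ (h : Freq → ℂ) (_ : InPastSpace (fun t => f t + g t) h), meanSquareError a h f g

/-- `P_{k,j} = (1 / 2π) ∫ e^{it(j-k)} / (f + g) dt`. -/
def coeffP (f g : Freq → ℝ) (k j : ℕ) : ℂ :=
  ∫ t, fourier ((j : ℤ) - k) t * ((1 / (f t + g t) : ℝ) : ℂ) ∂haarAddCircle

/-- `R_{k,j} = (1 / 2π) ∫ e^{-it(j+k)} f / (f + g) dt`. -/
def coeffR (f g : Freq → ℝ) (k j : ℕ) : ℂ :=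
  ∫ t, fourier (-((j : ℤ) + k)) t * ((f t / (f t + g t) : ℝ) : ℂ) ∂haarAddCircle

/-- `Q_{k,j} = (1 / 2π) ∫ e^{it(k-j)} f g / (f + g) dt`. For real sequences `a` the sign in the
exponent does not affect `⟨Q a, a⟩`; this is the sign for which
`⟨Q a, a⟩ = (1 / 2π) ∫ |A|² f g / (f + g) dt` holds for complex `a` too. -/
def coeffQ (f g : Freq → ℝ) (k j : ℕ) : ℂ :=
  ∫ t, fourier ((k : ℤ) - j) t * ((f t * g t / (f t + g t) : ℝ) : ℂ) ∂haarAddCircle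

/-- The vector `R a`, `(R a)_l = ∑_m R_{l+1,m} a(m)`. -/
def vecRa (a : ℕ → ℂ) (f g : Freq → ℝ) (l : ℕ) : ℂ :=
  ∑' m : ℕ, coeffR f g (l + 1) m * a m

/-- `(P x)_l = ∑_k P_{l+1,k+1} x_k` for a finitely supported vector `x`. -/
def applyP (f g : Freq → ℝ) (x : ℕ →₀ ℂ) (l : ℕ) : ℂ :=
  x.sum fun k z => coeffP f g (l + 1) (k + 1) * z

/-- The finite vectors `x n` converge to `c = P⁻¹ b`, and `C(t) = ∑_k c_k e^{it(k+1)}`.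

Since `1 / (f + g)` is only integrable, the matrix `P` acts on finite vectors and is extended to
their completion in its own energy norm
`⟨P x, x⟩ = (1 / 2π) ∫ |∑_k x_k e^{it(k+1)}|² / (f + g) dt`; the elements `c` of the completion are
identified with the functions `C` in the closed span of `e^{it(k+1)}`, `k ≥ 0`, in
`L₂(1 / (f + g))`. If `f + g` is bounded and bounded away from `0`, this is the inverse of the
bounded operator `P` on `ℓ₂`. -/
def ConvergesToInverse (f g : Freq → ℝ) (b : ℕ → ℂ) (x : ℕ → ℕ →₀ ℂ) (C : Freq → ℂ) : Prop :=
  AEStronglyMeasurable C (weight fun t => 1 / (f t + g t)) ∧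
  Tendsto (fun n => eLpNorm
      (fun t => C t - (x n).sum fun k z => z * fourier ((k : ℤ) + 1) t) 2
      (weight fun t => 1 / (f t + g t))) atTop (𝓝 0) ∧
  ∀ l, Tendsto (fun n => applyP f g (x n) l) atTop (𝓝 (b l))

/-- The function `∑_k (P⁻¹ b)_k e^{it(k+1)}` (unique up to a null set). -/
def inverseSeries (f g : Freq → ℝ) (b : ℕ → ℂ) : Freq → ℂ :=
  Classical.epsilon fun C => ∃ x, ConvergesToInverse f g b x C

/-- The number `⟨b, P⁻¹ b⟩`, i.e. the limit of `⟨b, x n⟩ = ∑_l b_l conj (x n)_l` for finite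
vectors `x n` converging to `P⁻¹ b`. -/
def inversePairing (f g : Freq → ℝ) (b : ℕ → ℂ) : ℂ :=
  Classical.epsilon fun v => ∃ x C, ConvergesToInverse f g b x C ∧
    Tendsto (fun n => (x n).sum fun l z => b l * starRingEnd ℂ z) atTop (𝓝 v)

/-- `C(e^{it}) = ∑_k (P⁻¹ R a)_k e^{it(k+1)}`. -/
def seriesC (a : ℕ → ℂ) (f g : Freq → ℝ) : Freq → ℂ :=
  inverseSeries f g (vecRa a f g)

/-- The spectral characteristic
`h(f, g) = A f / (f + g) - ∑_k (P⁻¹ R a)_k e^{it(k+1)} / (f + g)`. -/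
def specChar (a : ℕ → ℂ) (f g : Freq → ℝ) (t : Freq) : ℂ :=
  symbolA a t * ((f t / (f t + g t) : ℝ) : ℂ) - seriesC a f g t / ((f t + g t : ℝ) : ℂ)

/-- `h_g(f, g) = |A f - ∑_k (P⁻¹ R a)_k e^{it(k+1)}| / (f + g)`. -/
def hg (a : ℕ → ℂ) (f g : Freq → ℝ) (t : Freq) : ℝ :=
  ‖symbolA a t * (f t : ℂ) - seriesC a f g t‖ / (f t + g t)

/-- The functional `⟨R a, P⁻¹ R a⟩ + ⟨Q a, a⟩` (both terms are real). -/
def errorFunctional (a : ℕ → ℂ) (f g : Freq → ℝ) : ℝ :=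
  (inversePairing f g (vecRa a f g) +
    ∑' l : ℕ, (∑' k : ℕ, coeffQ f g l k * a k) * starRingEnd ℂ (a l)).re

/-- `(f₀, g₀)` solves the problem of maximizing `⟨R a, P⁻¹ R a⟩ + ⟨Q a, a⟩` over `Df × Dg`.
The functional is defined for the pairs satisfying the minimality condition. -/
def SolvesExtremalProblem (a : ℕ → ℂ) (Df Dg : Set (Freq → ℝ)) (f₀ g₀ : Freq → ℝ) : Prop :=
  f₀ ∈ Df ∧ g₀ ∈ Dg ∧ Minimality f₀ g₀ ∧
    ∀ f ∈ Df, ∀ g ∈ Dg, Minimality f g → errorFunctional a f g ≤ errorFunctional a f₀ g₀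

/-- `f₀ ∈ Df`, `g₀ ∈ Dg` are least favorable in `Df × Dg`. -/
def LeastFavorable (a : ℕ → ℂ) (Df Dg : Set (Freq → ℝ)) (f₀ g₀ : Freq → ℝ) : Prop :=
  f₀ ∈ Df ∧ g₀ ∈ Dg ∧ ∀ f ∈ Df, ∀ g ∈ Dg, optimalError a f g ≤ optimalError a f₀ g₀

/-- `H_D`, the intersection of the spaces `L₂⁰(f + g)` over `(f, g) ∈ Df × Dg`. -/
def admissibleChars (Df Dg : Set (Freq → ℝ)) : Set (Freq → ℂ) :=
  {h | ∀ f ∈ Df, ∀ g ∈ Dg, InPastSpace (fun t => f t + g t) h}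

/-- The worst-case error `sup_{(f, g) ∈ Df × Dg} Δ(h; f, g)`. -/
def worstError (a : ℕ → ℂ) (Df Dg : Set (Freq → ℝ)) (h : Freq → ℂ) : ENNReal :=
  ⨆ f ∈ Df, ⨆ g ∈ Dg, meanSquareError a h f g

/-- `h₀` is minimax-robust for `Df × Dg`: it minimizes the worst-case error over `H_D`. -/
def MinimaxRobust (a : ℕ → ℂ) (Df Dg : Set (Freq → ℝ)) (h₀ : Freq → ℂ) : Prop :=
  h₀ ∈ admissibleChars Df Dg ∧
    ∀ h ∈ admissibleChars Df Dg, worstError a Df Dg h₀ ≤ worstError a Df Dg h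

/-- The `ε`-contaminated class: spectral densities `g = (1 - ε) g₁ + ε w`, `w` a spectral density,
with `(1 / 2π) ∫ g ≤ P₂`. -/
def contaminatedClass (ε : ℝ) (g₁ : Freq → ℝ) (P₂ : ℝ) : Set (Freq → ℝ) :=
  {g | IsSpectralDensity g ∧
    (∃ w, IsSpectralDensity w ∧ ∀ᵐ t ∂haarAddCircle, g t = (1 - ε) * g₁ t + ε * w t) ∧
    ∫ t, g t ∂haarAddCircle ≤ P₂}

end RobustFiltering

end

open RobustFiltering

noncomputable section

namespace RobustFiltering

/-! ### Cesàro means of Fourier series -/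

/-! Write `p = f + g`, `Φ(g)` for the error functional and `h_g` for the spectral characteristic of
`(f, g)`. Multiplication by `p` is an isometry from `L₂(p)` to `L₂(1/p)`, and it turns "no positive
frequencies" into "orthogonal to all `e^{i(l+1)t}`, `l ≥ 0`". The matrix `P` is the Gram matrix of
these exponentials in `L₂(1/p)`, and `Ra` lists the inner products of `A f` with them. Hence `P⁻¹Ra`
is the orthogonal projection of `A f` onto their closed span. Completing the square and applying
Pythagoras gives, for every `k ∈ L₂(p)` without positive frequencies, `Δ(k; f, g) = Φ(g) + ‖k -
h_g‖²` in `L₂(p)` (`meanSquareError_eq_errorFunctional_add`).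

For fixed `k` the error is affine in `g`. Let `g_s = (1 - s) g₀ + s g`, and let `h_s` be its
spectral characteristic. Then `Φ(g_s) = Δ(h_s; f, g_s) = (1 - s)(Φ(g₀) + ‖h_s - h₀‖²) + s Δ(h_s; f,
g)`, with the norm taken in `L₂(f + g₀)`. Since `Φ(g_s) ≤ Φ(g₀)`, both `Δ(h_s; f, g) ≤ Φ(g₀)` and
`‖h_s - h₀‖² = O(s)` follow, and Fatou's lemma as `s → 0` gives `Δ(h₀; f, g) ≤ Φ(g₀)`
(`meanSquareError_specChar_le`). No derivative is computed, and `(f, g)` itself need not satisfy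
minimality, because `(f, g_s)` does for `s < 1`.

This is the saddle point inequality. To compare optimal errors, `h₀` must lie in every past space:
being bounded without positive frequencies, it is approximated by its Fejér means in every
integrable weight (`inPastSpace_of_bounded`). -/

lemma norm_fourier_apply (n : ℤ) (t : Freq) : ‖fourier n t‖ = 1 := by
  rw [fourier_apply]
  exact Circle.norm_coe _

lemma integral_fourier_eq_ite (n : ℤ) :
    ∫ t : Freq, fourier n t ∂haarAddCircle = if n = 0 then 1 else 0 := by
  have h := orthonormal_iff_ite.mp (orthonormal_fourier (T := 2 * π)) 0 n
  rw [ContinuousMap.inner_toLp] at h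
  simp only [fourier_zero, map_one, mul_one] at h
  rw [h]
  simp [eq_comm]

lemma integrable_mul_fourier {h : Freq → ℂ} (hh : Integrable h haarAddCircle) (n : ℤ) :
    Integrable (fun t => h t * fourier n t) haarAddCircle := by
  refine hh.mul_bdd (c := 1) (fourier n).continuous.aestronglyMeasurable 
    (ae_of_all _ fun t => (norm_fourier_apply n t).le)

lemma integrable_fourier_mul {h : Freq → ℂ} (hh : Integrable h haarAddCircle) (n : ℤ) :
    Integrable (fun t => fourier n t * h t) haarAddCircle := by
  simpa only [mul_comm] using integrable_mul_fourier hh n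

/-- The sum `∑_{j, k < N} ĥ(j - k) e^{i(j - k)t}`, that is `N` times a Fejér mean. -/
def fejerSum (h : Freq → ℂ) (N : ℕ) (t : Freq) : ℂ :=
  ∑ j ∈ Finset.range N, ∑ k ∈ Finset.range N,
    fourierCoeff h ((j : ℤ) - k) * fourier ((j : ℤ) - k) t

/-- Expanding the squared modulus exhibits the Fejér sum as an integral against a nonnegative
kernel, which is what makes sup-norm bounds available. -/
lemma integral_mul_normSq_dirichlet {h : Freq → ℂ} (hh : Integrable h haarAddCircle) (N : ℕ)
    (t : Freq) :
    ∫ s, h s * ((‖∑ j ∈ Finset.range N, fourier (j : ℤ) t * fourier (-(j : ℤ)) s‖ ^ 2 : ℝ) : ℂ)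
      ∂haarAddCircle = fejerSum h N t := by
  have key : ∀ s, h s *
      ((‖∑ j ∈ Finset.range N, fourier (j : ℤ) t * fourier (-(j : ℤ)) s‖ ^ 2 : ℝ) : ℂ) =
      ∑ j ∈ Finset.range N, ∑ k ∈ Finset.range N,
        (h s * fourier (-((j : ℤ) - k)) s) * fourier ((j : ℤ) - k) t := by
    intro s
    push_cast
    rw [← Complex.mul_conj', map_sum, Finset.sum_mul_sum, Finset.mul_sum]
    refine Finset.sum_congr rfl fun j _ => ?_
    rw [Finset.mul_sum]
    refine Finset.sum_congr rfl fun k _ => ?_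
    rw [map_mul, ← fourier_neg, ← fourier_neg, neg_neg,
      show -((j : ℤ) - k) = -j + k by ring, sub_eq_add_neg, fourier_add, fourier_add]
    ring
  simp_rw [key]
  rw [integral_finsetSum _ fun j _ => integrable_finsetSum _ fun k _ =>
    (integrable_mul_fourier hh _).mul_const _]
  refine Finset.sum_congr rfl fun j _ => ?_
  rw [integral_finsetSum _ fun k _ => (integrable_mul_fourier hh _).mul_const _]
  refine Finset.sum_congr rfl fun k _ => ?_
  rw [integral_mul_const, fourierCoeff]
  simp only [smul_eq_mul, mul_comm]

lemma integral_normSq_dirichlet (N : ℕ) (t : Freq) :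
    ∫ s : Freq, ‖∑ j ∈ Finset.range N, fourier (j : ℤ) t * fourier (-(j : ℤ)) s‖ ^ 2
      ∂haarAddCircle = N := by
  have h := integral_mul_normSq_dirichlet (h := fun _ => (1 : ℂ)) (integrable_const _) N t
  have hc : ∀ n : ℤ, fourierCoeff (T := 2 * π) (fun _ => (1 : ℂ)) n = if n = 0 then 1 else 0 := by
    intro n
    simp only [fourierCoeff, smul_eq_mul, mul_one, integral_fourier_eq_ite, neg_eq_zero]
  simp only [one_mul, fejerSum, hc, integral_complex_ofReal, sub_eq_zero, Nat.cast_inj, ite_mul,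
    zero_mul] at h
  rw [← Complex.ofReal_inj, h]
  have : ∀ j ∈ Finset.range N, (∑ k ∈ Finset.range N,
      if j = k then (fourier ((j : ℤ) - k) t : ℂ) else 0) = 1 := by
    intro j hj
    rw [Finset.sum_ite_eq]
    simp [hj]
  rw [Finset.sum_congr rfl this]
  simp

/-- The kernel is nonnegative with total mass `N`, so averaging against it preserves an a.e. bound
up to the factor `N`. -/
lemma norm_fejerSum_le {h : Freq → ℂ} {M : ℝ} (hh : Integrable h haarAddCircle)
    (hM : ∀ᵐ t ∂haarAddCircle, ‖h t‖ ≤ M) (N : ℕ) (t : Freq) :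
    ‖fejerSum h N t‖ ≤ M * N := by
  rw [← integral_mul_normSq_dirichlet hh, ← integral_normSq_dirichlet N t, ← integral_const_mul]
  refine norm_integral_le_of_norm_le ?_ ?_
  · refine Integrable.const_mul (Continuous.integrable_of_hasCompactSupport ?_ ?_) _
    · fun_prop
    · exact HasCompactSupport.of_compactSpace _
  · filter_upwards [hM] with s hs
    rw [norm_mul, Complex.norm_real, Real.norm_of_nonneg (by positivity)]
    gcongr

/-- The symmetric partial sums of a Fourier series. -/
def fourierPartialSum (h : Freq → ℂ) (n : ℕ) (t : Freq) : ℂ :=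
  ∑ i ∈ Finset.Icc (-(n : ℤ)) n, fourierCoeff h i * fourier i t

/-- Passing from `N` to `N + 1` adds the row `j = N` and the column `k = N`, whose frequencies `N -
k` and `j - N` run exactly once through `-N, …, N`. -/
lemma fejerSum_eq_sum_fourierPartialSum (h : Freq → ℂ) (N : ℕ) (t : Freq) :
    fejerSum h N t = ∑ n ∈ Finset.range N, fourierPartialSum h n t := by
  have split : ∀ (u : ℤ → ℂ) (n : ℕ), ∑ i ∈ Finset.Icc (-(n : ℤ)) n, u i =
      ∑ k ∈ Finset.range (n + 1), u ((n : ℤ) - k) + ∑ j ∈ Finset.range n, u ((j : ℤ) - n) := by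
    intro u n
    have hd : Finset.Icc (-(n : ℤ)) n =
        (Finset.range (n + 1)).image (fun k : ℕ => (n : ℤ) - k) ∪
          (Finset.range n).image (fun j : ℕ => (j : ℤ) - n) := by
      ext i
      simp only [Finset.mem_Icc, Finset.mem_union, Finset.mem_image, Finset.mem_range]
      constructor
      · rintro ⟨h1, h2⟩
        by_cases hi : 0 ≤ i
        · exact Or.inl ⟨(n - i).toNat, by omega, by omega⟩
        · exact Or.inr ⟨(n + i).toNat, by omega, by omega⟩
      · rintro (⟨k, hk, rfl⟩ | ⟨k, hk, rfl⟩) <;> omega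
    rw [hd, Finset.sum_union, Finset.sum_image, Finset.sum_image]
    · intro x _ y _ hxy
      simpa using hxy
    · intro x _ y _ hxy
      simpa using hxy
    · rw [Finset.disjoint_left]
      simp only [Finset.mem_image, Finset.mem_range, not_exists]
      rintro _ ⟨k, hk, rfl⟩ x
      omega
  induction N with
  | zero => simp [fejerSum]
  | succ N ih =>
    rw [Finset.sum_range_succ, ← ih, fourierPartialSum,
      split (fun i => fourierCoeff h i * fourier i t) N]
    simp only [fejerSum]
    rw [Finset.sum_range_succ]
    simp_rw [Finset.sum_range_succ _ N]
    rw [Finset.sum_add_distrib]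
    ring

lemma memLp_fourier (μ : Measure Freq) [IsFiniteMeasure μ] (p : ENNReal) (n : ℤ) :
    MemLp (fun t => fourier n t) p μ :=
  MemLp.of_bound (fourier n).continuous.aestronglyMeasurable 1
    (ae_of_all _ fun t => (norm_fourier_apply n t).le)

lemma memLp_const_mul_fourier (μ : Measure Freq) [IsFiniteMeasure μ] (p : ENNReal) (n : ℤ) (c : ℂ) :
    MemLp (fun t => c * fourier n t) p μ :=
  (memLp_fourier μ p n).const_mul c

lemma memLp_fourierPartialSum (h : Freq → ℂ) (n : ℕ) :
    MemLp (fourierPartialSum h n) 2 haarAddCircle :=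
  memLp_finsetSum _ fun i _ => memLp_const_mul_fourier _ _ i _

lemma toLp_sum {ι : Type*} {μ : Measure Freq} (s : Finset ι) (c : ι → ℂ) (F : ι → Freq → ℂ)
    (hF : ∀ i, MemLp (F i) 2 μ) (h : MemLp (fun t => ∑ i ∈ s, c i * F i t) 2 μ) :
    h.toLp = ∑ i ∈ s, c i • (hF i).toLp := by
  classical
  induction s using Finset.induction_on with
  | empty => exact MemLp.toLp_zero _
  | insert a s ha ih =>
    have h1 : MemLp (fun t => ∑ i ∈ s, c i * F i t) 2 μ :=
      memLp_finsetSum _ fun i _ => (hF i).const_mul _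
    rw [Finset.sum_insert ha, ← ih h1, ← MemLp.toLp_const_smul, ← MemLp.toLp_add]
    refine MemLp.toLp_congr _ _ (ae_of_all _ fun t => ?_)
    simp [Finset.sum_insert ha]

lemma toLp_fourierPartialSum (h : Freq → ℂ) (n : ℕ) :
    (memLp_fourierPartialSum h n).toLp =
      ∑ i ∈ Finset.Icc (-(n : ℤ)) n, fourierCoeff h i • fourierLp 2 i :=
  toLp_sum _ _ (fun i t => fourier i t) (fun i => memLp_fourier _ 2 i) _

lemma tendsto_eLpNorm_fejer {h : Freq → ℂ} (hh : MemLp h 2 haarAddCircle) :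
    Tendsto (fun N : ℕ => eLpNorm ((fun t => (N : ℂ)⁻¹ * fejerSum h N t) - h) 2 haarAddCircle)
      atTop (𝓝 0) := by
  have hN : ∀ N : ℕ, MemLp (fun t => (N : ℂ)⁻¹ * fejerSum h N t) 2 haarAddCircle := by
    intro N
    simp_rw [fejerSum_eq_sum_fourierPartialSum]
    exact (memLp_finsetSum _ fun i _ => memLp_fourierPartialSum h i).const_mul _
  rw [← Lp.tendsto_Lp_iff_tendsto_eLpNorm'' _ hN _ hh]
  have h1 := hasSum_fourier_series_L2 hh.toLp
  -- Symmetric intervals exhaust `ℤ`, so the unconditional sum is the limit of the symmetric partial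
  -- sums, and Cesàro averaging keeps the limit.
  have h2 : Tendsto (fun n : ℕ => Finset.Icc (-(n : ℤ)) n) atTop atTop := by
    refine tendsto_atTop_finset_of_monotone (fun a b hab => ?_) fun i => ⟨i.natAbs, ?_⟩
    · exact Finset.Icc_subset_Icc (by omega) (by omega)
    · simp only [Finset.mem_Icc]; omega
  have h3 := (Tendsto.comp h1 h2).cesaro_smul
  refine h3.congr fun N => ?_
  have hc : ∀ i, fourierCoeff hh.toLp i = fourierCoeff h i := by
    intro i
    refine integral_congr_ae ?_
    filter_upwards [hh.coeFn_toLp] with t ht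
    rw [ht]
  simp only [Function.comp_def, hc, ← toLp_fourierPartialSum]
  have hp : MemLp (fun t => ∑ n ∈ Finset.range N, (1 : ℂ) * fourierPartialSum h n t) 2
      haarAddCircle := memLp_finsetSum _ fun i _ => (memLp_fourierPartialSum h i).const_mul _
  have := toLp_sum (Finset.range N) (fun _ => 1) (fun n => fourierPartialSum h n)
    (memLp_fourierPartialSum h) hp
  simp only [one_smul] at this
  rw [← this, ← MemLp.toLp_const_smul]
  refine MemLp.toLp_congr _ _ (ae_of_all _ fun t => ?_)
  simp [fejerSum_eq_sum_fourierPartialSum]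

lemma eLpNorm_two_sq {α : Type*} [MeasurableSpace α] (μ : Measure α) (u : α → ℂ) :
    eLpNorm u 2 μ ^ 2 = ∫⁻ t, ‖u t‖ₑ ^ 2 ∂μ := by
  have := eLpNorm_nnreal_pow_eq_lintegral (μ := μ) (f := u) (p := 2) (by norm_num)
  simpa only [NNReal.coe_ofNat, ENNReal.coe_ofNat, ENNReal.rpow_two] using this

lemma weight_absolutelyContinuous (p : Freq → ℝ) : weight p ≪ haarAddCircle :=
  withDensity_absolutelyContinuous _ _

lemma isFiniteMeasure_weight {p : Freq → ℝ} (hp : Integrable p haarAddCircle) :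
    IsFiniteMeasure (weight p) :=
  isFiniteMeasure_withDensity_ofReal hp.2

lemma exists_finsupp_eq_fejerSum {h : Freq → ℂ} (hc : ∀ l : ℕ, fourierCoeff h ((l : ℤ) + 1) = 0)
    (c : ℂ) (N : ℕ) : ∃ x : ℕ →₀ ℂ, ∀ t : Freq,
      c * fejerSum h N t = x.sum fun m z => z * fourier (-(m : ℤ)) t := by
  have hmem : (fun t => c * fejerSum h N t) ∈
      Submodule.span ℂ (Set.range fun (m : ℕ) (t : Freq) => (fourier (-(m : ℤ)) t : ℂ)) := by
    have : (fun t => c * fejerSum h N t) = c • ∑ j ∈ Finset.range N, ∑ k ∈ Finset.range N,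
        fourierCoeff h ((j : ℤ) - k) • fun t : Freq => (fourier ((j : ℤ) - k) t : ℂ) := by
      ext t
      simp [fejerSum]
    rw [this]
    refine Submodule.smul_mem _ _ (Submodule.sum_mem _ fun j _ => Submodule.sum_mem _ fun k _ => ?_)
    rcases le_or_gt j k with hjk | hjk
    · refine Submodule.smul_mem _ _ (Submodule.subset_span ⟨k - j, ?_⟩)
      simp only [show -((k - j : ℕ) : ℤ) = (j : ℤ) - k by omega]
    -- A positive frequency `j - k` is written as `(j - k - 1) + 1` to match `hc`; its coefficient
    -- vanishes.
    · have := hc (j - k - 1)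
      rw [show ((j - k - 1 : ℕ) : ℤ) + 1 = (j : ℤ) - k by omega] at this
      simp [this]
  obtain ⟨x, hx⟩ := Finsupp.mem_span_range_iff_exists_finsupp.mp hmem
  refine ⟨x, fun t => ?_⟩
  have := congrFun hx t
  simp only [Finsupp.sum, Finset.sum_apply, Pi.smul_apply, smul_eq_mul] at this
  rw [← this, Finsupp.sum]

/-- A bounded function without positive frequencies lies in the past space of every integrable
weight. -/
lemma inPastSpace_of_bounded {p : Freq → ℝ} (hp : Integrable p haarAddCircle) {h : Freq → ℂ} {M : ℝ}
    (hm : AEStronglyMeasurable h haarAddCircle) (hM : ∀ᵐ t ∂haarAddCircle, ‖h t‖ ≤ M)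
    (hc : ∀ l : ℕ, fourierCoeff h ((l : ℤ) + 1) = 0) : InPastSpace p h := by
  have := isFiniteMeasure_weight hp
  have hac := weight_absolutelyContinuous p
  have hL2 : MemLp h 2 haarAddCircle := MemLp.of_bound hm M hM
  have hint : Integrable h haarAddCircle := hL2.integrable (by norm_num)
  refine ⟨MemLp.of_bound (hm.mono_ac hac) M (hac.ae_le hM), fun δ hδ => ?_⟩
  have hcont : ∀ N : ℕ, Continuous (fun t => (N : ℂ)⁻¹ * fejerSum h N t) := fun N => by
    unfold fejerSum
    fun_prop
  -- Unweighted `L²` convergence says nothing directly about an unbounded weight. An a.e. convergent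
  -- subsequence, uniformly bounded by `|M|`, allows dominated convergence in the finite measure
  -- `weight p`.
  obtain ⟨ns, -, hns⟩ := (tendstoInMeasure_of_tendsto_eLpNorm two_ne_zero
    (fun N => (hcont N).aestronglyMeasurable) hm (tendsto_eLpNorm_fejer hL2)).exists_seq_tendsto_ae
  have hbound : ∀ (N : ℕ) (t : Freq), ‖(N : ℂ)⁻¹ * fejerSum h N t‖ ≤ |M| := by
    intro N t
    rw [norm_mul, norm_inv, Complex.norm_natCast]
    rcases Nat.eq_zero_or_pos N with rfl | hN
    · simp
    · have hN' : (0 : ℝ) < N := by exact_mod_cast hN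
      rw [inv_mul_le_iff₀ hN', mul_comm]
      exact (norm_fejerSum_le hint hM N t).trans (by gcongr; exact le_abs_self M)
  have hlim : Tendsto (fun n => ∫⁻ t, ‖h t - ((ns n : ℕ) : ℂ)⁻¹ * fejerSum h (ns n) t‖ₑ ^ 2 ∂weight p)
      atTop (𝓝 (∫⁻ _, 0 ∂weight p)) := by
    refine tendsto_lintegral_of_dominated_convergence'
      (fun _ => ENNReal.ofReal (|M| + |M|) ^ 2) (fun n => ?_) (fun n => ?_) ?_ ?_
    · exact ((hm.mono_ac hac).sub (hcont _).aestronglyMeasurable).enorm.pow_const 2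
    · filter_upwards [hac.ae_le hM] with t ht
      gcongr
      rw [← ofReal_norm]
      exact ENNReal.ofReal_le_ofReal ((norm_sub_le _ _).trans
        (add_le_add (ht.trans (le_abs_self M)) (hbound _ t)))
    · rw [lintegral_const]
      exact ENNReal.mul_ne_top (by simp) (measure_ne_top _ _)
    · filter_upwards [hac.ae_le hns] with t ht
      have h1 := (tendsto_const_nhds (x := h t)).sub ht
      rw [sub_self] at h1
      simpa using ENNReal.Tendsto.pow (n := 2) h1.enorm
  rw [lintegral_zero] at hlim
  obtain ⟨n, hn⟩ := (hlim.eventually_lt_const (u := δ ^ 2) (by positivity)).exists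
  obtain ⟨x, hx⟩ := exists_finsupp_eq_fejerSum hc ((ns n : ℂ)⁻¹) (ns n)
  refine ⟨x, ?_⟩
  simp_rw [← hx]
  rw [← eLpNorm_two_sq] at hn
  exact lt_of_not_ge fun hle => hn.not_ge (by gcongr)

/-! ### Weighted spaces -/

/-- A positive integrable weight with integrable reciprocal. -/
structure RegularWeight (p : Freq → ℝ) : Prop where
  integrable : Integrable p haarAddCircle
  pos : ∀ᵐ t ∂haarAddCircle, 0 < p t
  integrable_inv : Integrable (fun t => 1 / p t) haarAddCircle

/-- The extended reciprocal is infinite wherever `f + g ≤ 0`, so its finite integral forces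
positivity almost everywhere. -/
lemma Minimality.regularWeight {f g : Freq → ℝ} (hf : IsSpectralDensity f)
    (hg : IsSpectralDensity g) (hmin : Minimality f g) : RegularWeight fun t => f t + g t := by
  have hint : Integrable (fun t => f t + g t) haarAddCircle := hf.1.add hg.1
  have hpos : ∀ᵐ t ∂haarAddCircle, 0 < f t + g t := by
    filter_upwards [ae_lt_top' hint.aemeasurable.ennreal_ofReal.inv hmin.ne] with t ht
    by_contra hle
    simp [ENNReal.ofReal_of_nonpos (not_lt.mp hle)] at ht
  refine ⟨hint, hpos, (hint.aemeasurable.const_div 1).aestronglyMeasurable, ?_⟩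
  rw [hasFiniteIntegral_iff_enorm]
  refine lt_of_eq_of_lt (lintegral_congr_ae ?_) hmin
  filter_upwards [hpos] with t ht
  rw [one_div, ← ofReal_norm, Real.norm_of_nonneg (by positivity), ENNReal.ofReal_inv_of_pos ht]

lemma lintegral_weight {p : Freq → ℝ} (hp : AEMeasurable p haarAddCircle) (F : Freq → ENNReal) :
    ∫⁻ t, F t ∂weight p = ∫⁻ t, ENNReal.ofReal (p t) * F t ∂haarAddCircle :=
  lintegral_withDensity_eq_lintegral_mul_non_measurable₀ _ hp.ennreal_ofReal
    (ae_of_all _ fun _ => ENNReal.ofReal_lt_top) _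

lemma integral_weight {p : Freq → ℝ} (hp : AEMeasurable p haarAddCircle)
    (h0 : ∀ᵐ t ∂haarAddCircle, 0 < p t) (F : Freq → ℂ) :
    ∫ t, F t ∂weight p = ∫ t, F t * (p t : ℂ) ∂haarAddCircle := by
  rw [weight, integral_withDensity_eq_integral_toReal_smul₀ hp.ennreal_ofReal
    (ae_of_all _ fun _ => ENNReal.ofReal_lt_top)]
  refine integral_congr_ae ?_
  filter_upwards [h0] with t ht
  rw [ENNReal.toReal_ofReal ht.le, Complex.real_smul, mul_comm]

lemma absolutelyContinuous_weight {p : Freq → ℝ} (hp : AEMeasurable p haarAddCircle)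
    (h0 : ∀ᵐ t ∂haarAddCircle, 0 < p t) : haarAddCircle ≪ weight p := by
  refine withDensity_absolutelyContinuous' hp.ennreal_ofReal ?_
  filter_upwards [h0] with t ht
  simpa using ht

/-- The measure `(1 / 2π) dt / p(t)`. -/
abbrev invWeight (p : Freq → ℝ) : Measure Freq := weight fun t => 1 / p t

lemma memLp_two_iff {α : Type*} [MeasurableSpace α] {μ : Measure α} {u : α → ℂ}
    (hu : AEStronglyMeasurable u μ) : MemLp u 2 μ ↔ ∫⁻ t, ‖u t‖ₑ ^ 2 ∂μ < ⊤ := by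
  rw [← eLpNorm_two_sq]
  exact ⟨fun h => ENNReal.pow_lt_top h.2, fun h => ⟨hu, by simpa using h⟩⟩

lemma lintegral_enorm_sq_eq {α : Type*} [MeasurableSpace α] {μ : Measure α} {u : α → ℂ}
    (hu : MemLp u 2 μ) : ∫⁻ t, ‖u t‖ₑ ^ 2 ∂μ = ENNReal.ofReal (‖hu.toLp‖ ^ 2) := by
  rw [Lp.norm_toLp, ← eLpNorm_two_sq, ENNReal.ofReal_pow ENNReal.toReal_nonneg,
    ENNReal.ofReal_toReal hu.2.ne]

namespace RegularWeight

variable {p : Freq → ℝ}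

lemma pos_inv (W : RegularWeight p) : ∀ᵐ t ∂haarAddCircle, 0 < 1 / p t := by
  filter_upwards [W.pos] with t ht
  positivity

lemma isFiniteMeasure (W : RegularWeight p) : IsFiniteMeasure (weight p) :=
  isFiniteMeasure_weight W.integrable

lemma isFiniteMeasure_inv (W : RegularWeight p) : IsFiniteMeasure (invWeight p) :=
  isFiniteMeasure_weight W.integrable_inv

lemma haar_ac (W : RegularWeight p) : haarAddCircle ≪ weight p :=
  absolutelyContinuous_weight W.integrable.aemeasurable W.pos

lemma haar_ac_inv (W : RegularWeight p) : haarAddCircle ≪ invWeight p :=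
  absolutelyContinuous_weight W.integrable_inv.aemeasurable W.pos_inv

/-- Pointwise `|k p|² / p = |k|² p`: multiplication by `p` is an isometry from `L₂(p)` to `L₂(1/p)`.
-/
lemma lintegral_mul_inv (W : RegularWeight p) (k : Freq → ℂ) :
    ∫⁻ t, ‖k t * (p t : ℂ)‖ₑ ^ 2 ∂invWeight p = ∫⁻ t, ‖k t‖ₑ ^ 2 ∂weight p := by
  rw [lintegral_weight W.integrable.aemeasurable, lintegral_weight W.integrable_inv.aemeasurable]
  refine lintegral_congr_ae ?_
  filter_upwards [W.pos] with t ht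
  rw [enorm_mul, mul_pow, ← ofReal_norm (p t : ℂ), Complex.norm_real, Real.norm_of_nonneg ht.le,
    mul_comm (‖k t‖ₑ ^ 2), ← mul_assoc, ← ENNReal.ofReal_pow ht.le,
    ← ENNReal.ofReal_mul (by positivity)]
  congr 2
  field_simp

lemma memLp_mul (W : RegularWeight p) {k : Freq → ℂ} (hk : MemLp k 2 (weight p)) :
    MemLp (fun t => k t * (p t : ℂ)) 2 (invWeight p) := by
  have hm : AEStronglyMeasurable (fun t => k t * (p t : ℂ)) haarAddCircle :=
    (hk.1.mono_ac W.haar_ac).mul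
      (Complex.continuous_ofReal.comp_aestronglyMeasurable W.integrable.1)
  rw [memLp_two_iff (hm.mono_ac (weight_absolutelyContinuous _)), W.lintegral_mul_inv]
  exact (memLp_two_iff hk.1).mp hk

lemma memLp_of_memLp_mul (W : RegularWeight p) {k : Freq → ℂ}
    (hm : AEStronglyMeasurable k haarAddCircle)
    (hk : MemLp (fun t => k t * (p t : ℂ)) 2 (invWeight p)) : MemLp k 2 (weight p) := by
  rw [memLp_two_iff (hm.mono_ac (weight_absolutelyContinuous _)), ← W.lintegral_mul_inv]
  exact (memLp_two_iff hk.1).mp hk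

lemma inner_toLp (W : RegularWeight p) {u v : Freq → ℂ} (hu : MemLp u 2 (invWeight p))
    (hv : MemLp v 2 (invWeight p)) :
    inner ℂ hu.toLp hv.toLp =
      ∫ t, starRingEnd ℂ (u t) * v t * ((1 / p t : ℝ) : ℂ) ∂haarAddCircle := by
  rw [L2.inner_def, ← integral_weight W.integrable_inv.aemeasurable W.pos_inv
    fun t => starRingEnd ℂ (u t) * v t]
  refine integral_congr_ae ?_
  filter_upwards [hu.coeFn_toLp, hv.coeFn_toLp] with t h1 h2
  rw [h1, h2, RCLike.inner_apply, mul_comm]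

/-- The vector `e^{i(l+1)t}` of `L₂(1 / p)`. -/
def expVec (W : RegularWeight p) (l : ℕ) : Lp ℂ 2 (invWeight p) :=
  have := W.isFiniteMeasure_inv
  (memLp_fourier (invWeight p) 2 ((l : ℤ) + 1)).toLp

/-- The closed linear span of `e^{i(l+1)t}`, `l ≥ 0`, in `L₂(1 / p)`. -/
def futureSpace (W : RegularWeight p) : Submodule ℂ (Lp ℂ 2 (invWeight p)) :=
  (Submodule.span ℂ (Set.range W.expVec)).topologicalClosure

instance (W : RegularWeight p) : W.futureSpace.HasOrthogonalProjection :=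
  have : CompleteSpace W.futureSpace :=
    (Submodule.isClosed_topologicalClosure _).completeSpace_coe
  inferInstance

lemma mem_orthogonal_futureSpace (W : RegularWeight p) {v : Lp ℂ 2 (invWeight p)}
    (hv : ∀ l, inner ℂ (W.expVec l) v = 0) : v ∈ W.futureSpaceᗮ := by
  rw [futureSpace, Submodule.orthogonal_closure, Submodule.mem_orthogonal]
  intro u hu
  induction hu using Submodule.span_induction with
  | mem x hx => obtain ⟨l, rfl⟩ := hx; exact hv l
  | zero => simp
  | add x y _ _ hx hy => rw [inner_add_left, hx, hy, add_zero]
  | smul c x _ hx => rw [inner_smul_left, hx, mul_zero]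

lemma expVec_mem (W : RegularWeight p) (l : ℕ) : W.expVec l ∈ W.futureSpace :=
  Submodule.le_topologicalClosure _ (Submodule.subset_span ⟨l, rfl⟩)

/-- The factor `p` cancels the weight `1/p`, leaving an ordinary Fourier coefficient. Vanishing
positive frequencies thus become orthogonality to `futureSpace`. -/
lemma inner_expVec_mul (W : RegularWeight p) {k : Freq → ℂ}
    (hk : MemLp (fun t => k t * (p t : ℂ)) 2 (invWeight p)) (l : ℕ) :
    inner ℂ (W.expVec l) hk.toLp = fourierCoeff k ((l : ℤ) + 1) := by
  rw [expVec, W.inner_toLp, fourierCoeff]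
  refine integral_congr_ae ?_
  filter_upwards [W.pos] with t ht
  have : (p t : ℂ) ≠ 0 := by exact_mod_cast ht.ne'
  rw [fourier_neg, smul_eq_mul]
  push_cast
  field_simp

lemma memLp_finsupp (W : RegularWeight p) (x : ℕ →₀ ℂ) :
    MemLp (fun t => x.sum fun k z => z * fourier ((k : ℤ) + 1) t) 2 (invWeight p) :=
  have := W.isFiniteMeasure_inv
  memLp_finsetSum _ fun _ _ => memLp_const_mul_fourier _ 2 _ _

lemma toLp_finsupp (W : RegularWeight p) (x : ℕ →₀ ℂ) :
    (W.memLp_finsupp x).toLp = x.sum fun k z => z • W.expVec k :=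
  have := W.isFiniteMeasure_inv
  toLp_sum x.support x (fun k t => fourier ((k : ℤ) + 1) t) (fun _ => memLp_fourier _ 2 _) _

lemma toLp_finsupp_mem (W : RegularWeight p) (x : ℕ →₀ ℂ) :
    (W.memLp_finsupp x).toLp ∈ W.futureSpace := by
  rw [W.toLp_finsupp]
  exact Submodule.sum_mem _ fun k _ => Submodule.smul_mem _ _ (W.expVec_mem k)

end RegularWeight

/-- `P` is the Gram matrix of the exponentials `e^{i(l+1)t}` in `L₂(1/(f+g))`. -/
lemma inner_expVec_finsupp {f g : Freq → ℝ} (W : RegularWeight fun t => f t + g t) (x : ℕ →₀ ℂ)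
    (l : ℕ) : inner ℂ (W.expVec l) (W.memLp_finsupp x).toLp = applyP f g x l := by
  rw [W.toLp_finsupp, Finsupp.sum, inner_sum, applyP, Finsupp.sum]
  refine Finset.sum_congr rfl fun k _ => ?_
  rw [inner_smul_right, mul_comm]
  congr 1
  rw [RegularWeight.expVec, RegularWeight.expVec, W.inner_toLp, coeffP]
  refine integral_congr_ae (ae_of_all _ fun t => ?_)
  simp only
  rw [← fourier_neg, ← fourier_add]
  push_cast
  congr 3

/-! ### Inverting `P` as orthogonal projection onto the future space -/

section Inverse

variable {f g : Freq → ℝ} (W : RegularWeight fun t => f t + g t)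
  {v : Lp ℂ 2 (invWeight fun t => f t + g t)}

lemma ConvergesToInverse.memLp (W : RegularWeight fun t => f t + g t) {b : ℕ → ℂ} {x : ℕ → ℕ →₀ ℂ} {C : Freq → ℂ}
    (h : ConvergesToInverse f g b x C) : MemLp C 2 (invWeight fun t => f t + g t) := by
  obtain ⟨n, hn⟩ := (h.2.1.eventually_lt_const ENNReal.zero_lt_top).exists
  have h1 : MemLp (fun t => C t - (x n).sum fun k z => z * fourier ((k : ℤ) + 1) t) 2
      (invWeight fun t => f t + g t) := ⟨h.1.sub (W.memLp_finsupp _).1, hn⟩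
  convert h1.add (W.memLp_finsupp (x n)) using 1
  ext t
  simp

lemma ConvergesToInverse.tendsto_toLp {b : ℕ → ℂ} {x : ℕ → ℕ →₀ ℂ} {C : Freq → ℂ}
    (h : ConvergesToInverse f g b x C) :
    Tendsto (fun n => (W.memLp_finsupp (x n)).toLp) atTop (𝓝 (h.memLp W).toLp) := by
  rw [Lp.tendsto_Lp_iff_tendsto_eLpNorm'' _ (fun n => W.memLp_finsupp (x n))]
  refine h.2.1.congr fun n => ?_
  rw [← eLpNorm_neg]
  congr 1
  ext t
  simp

/-- The limit lies in the closed span and has the same inner products with the generators as `v`,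
which characterizes the projection. In particular it does not depend on the approximating sequence.
-/
lemma ConvergesToInverse.toLp_eq {x : ℕ → ℕ →₀ ℂ} {C : Freq → ℂ}
    (h : ConvergesToInverse f g (fun l => inner ℂ (W.expVec l) v) x C) :
    (h.memLp W).toLp = W.futureSpace.starProjection v := by
  have ht := h.tendsto_toLp W
  symm
  refine Submodule.eq_starProjection_of_mem_orthogonal ?_ (W.mem_orthogonal_futureSpace fun l => ?_)
  · exact (Submodule.isClosed_topologicalClosure _).mem_of_tendsto ht
      (Eventually.of_forall fun n => W.toLp_finsupp_mem _)
  · rw [inner_sub_right, sub_eq_zero]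
    refine tendsto_nhds_unique (h.2.2 l) ?_
    simp_rw [← inner_expVec_finsupp W]
    exact tendsto_const_nhds.inner ht

lemma exists_convergesToInverse (v : Lp ℂ 2 (invWeight fun t => f t + g t)) :
    ∃ C x, ConvergesToInverse f g (fun l => inner ℂ (W.expVec l) v) x C := by
  have hmem : W.futureSpace.starProjection v ∈ W.futureSpace :=
    Submodule.starProjection_apply_mem _ _
  obtain ⟨y, hy, hlim⟩ := mem_closure_iff_seq_limit.mp hmem
  choose x hx using fun n => Finsupp.mem_span_range_iff_exists_finsupp.mp (hy n)
  simp_rw [← W.toLp_finsupp] at hx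
  have hlim' : Tendsto (fun n => (W.memLp_finsupp (x n)).toLp) atTop
      (𝓝 (W.futureSpace.starProjection v)) := by simpa only [hx] using hlim
  refine ⟨W.futureSpace.starProjection v, x, Lp.aestronglyMeasurable _, ?_, fun l => ?_⟩
  · rw [← Lp.toLp_coeFn (W.futureSpace.starProjection v) (Lp.memLp _),
      Lp.tendsto_Lp_iff_tendsto_eLpNorm'' _ (fun n => W.memLp_finsupp (x n))] at hlim'
    refine hlim'.congr fun n => ?_
    rw [← eLpNorm_neg]
    congr 1
    ext t
    simp
  · simp_rw [← inner_expVec_finsupp W]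
    have h1 : inner ℂ (W.expVec l) v =
        inner ℂ (W.expVec l) (W.futureSpace.starProjection v) := by
      rw [← sub_eq_zero, ← inner_sub_right, ← inner_conj_symm,
        Submodule.starProjection_inner_eq_zero _ _ (W.expVec_mem l), map_zero]
    rw [h1]
    exact tendsto_const_nhds.inner hlim'

lemma inverseSeries_spec (v : Lp ℂ 2 (invWeight fun t => f t + g t)) :
    ∃ h : MemLp (inverseSeries f g fun l => inner ℂ (W.expVec l) v) 2
      (invWeight fun t => f t + g t), h.toLp = W.futureSpace.starProjection v := by
  obtain ⟨x, hx⟩ := Classical.epsilon_spec (exists_convergesToInverse W v)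
  exact ⟨hx.memLp W, hx.toLp_eq W⟩

/-- For `b_l = ⟨e_l, v⟩`, the pairing with a finite vector is the inner product of its trigonometric
sum with `v`; in the limit this becomes `⟨Kv, v⟩ = ‖Kv‖²`, where `K` is the projection. -/
lemma inversePairing_eq (v : Lp ℂ 2 (invWeight fun t => f t + g t)) :
    inversePairing f g (fun l => inner ℂ (W.expVec l) v) =
      ((‖W.futureSpace.starProjection v‖ ^ 2 : ℝ) : ℂ) := by
  have key : ∀ x C, ConvergesToInverse f g (fun l => inner ℂ (W.expVec l) v) x C →
      Tendsto (fun n => (x n).sum fun l z => inner ℂ (W.expVec l) v * starRingEnd ℂ z) atTop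
        (𝓝 ((‖W.futureSpace.starProjection v‖ ^ 2 : ℝ) : ℂ)) := by
    intro x C h
    have h1 := (h.tendsto_toLp W).inner (𝕜 := ℂ) (tendsto_const_nhds (x := v))
    rw [h.toLp_eq W] at h1
    have h2 : inner ℂ (W.futureSpace.starProjection v) v =
        ((‖W.futureSpace.starProjection v‖ ^ 2 : ℝ) : ℂ) := by
      have h3 : inner ℂ (W.futureSpace.starProjection v) (v - W.futureSpace.starProjection v) = 0 := by
        rw [← inner_conj_symm, Submodule.starProjection_inner_eq_zero _ _
          (Submodule.starProjection_apply_mem _ _), map_zero]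
      rw [inner_sub_right, sub_eq_zero] at h3
      rw [h3, inner_self_eq_norm_sq_to_K]
      push_cast
      rfl
    rw [h2] at h1
    refine h1.congr fun n => ?_
    rw [W.toLp_finsupp, Finsupp.sum, sum_inner, Finsupp.sum]
    refine Finset.sum_congr rfl fun k _ => ?_
    rw [inner_smul_left, mul_comm]
  obtain ⟨C, x, hx⟩ := exists_convergesToInverse W v
  obtain ⟨x', C', h', hlim⟩ := Classical.epsilon_spec (p := fun v' => ∃ x C,
    ConvergesToInverse f g (fun l => inner ℂ (W.expVec l) v) x C ∧
    Tendsto (fun n => (x n).sum fun l z => inner ℂ (W.expVec l) v * starRingEnd ℂ z) atTop (𝓝 v'))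
    ⟨_, x, C, hx, key x C hx⟩
  exact tendsto_nhds_unique hlim (key x' C' h')

end Inverse

/-! ### The symbol and the error functional -/

section Symbol

variable {a : ℕ → ℂ}

lemma continuous_symbolA (ha : Summable fun k => ‖a k‖) : Continuous (symbolA a) :=
  continuous_tsum (fun k => by fun_prop) ha fun k t => by rw [norm_mul, norm_fourier_apply, mul_one]

lemma norm_symbolA_le (ha : Summable fun k => ‖a k‖) (t : Freq) :
    ‖symbolA a t‖ ≤ ∑' k, ‖a k‖ :=
  tsum_of_norm_bounded ha.hasSum fun k => by rw [norm_mul, norm_fourier_apply, mul_one]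

/-- Absolute summability of `a` and integrability of `φ` justify exchanging sum and integral. -/
lemma hasSum_integral_symbolA (ha : Summable fun k => ‖a k‖) {φ : Freq → ℂ}
    (hφ : Integrable φ haarAddCircle) :
    HasSum (fun k : ℕ => (∫ t, fourier (-(k : ℤ)) t * φ t ∂haarAddCircle) * a k)
      (∫ t, symbolA a t * φ t ∂haarAddCircle) := by
  have h := hasSum_integral_of_summable_integral_norm (μ := haarAddCircle)
    (F := fun (k : ℕ) t => a k * (fourier (-(k : ℤ)) t * φ t))
    (fun k => (integrable_fourier_mul hφ _).const_mul _) ?_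
  · have e : ∫ t : Freq, symbolA a t * φ t ∂haarAddCircle =
        ∫ t, ∑' k : ℕ, a k * (fourier (-(k : ℤ)) t * φ t) ∂haarAddCircle :=
      integral_congr_ae (ae_of_all _ fun t => by simp only [symbolA, ← mul_assoc, tsum_mul_right])
    rw [e]
    simpa only [integral_mul_const, mul_comm (a _)] using h
  · simp_rw [norm_mul, norm_fourier_apply, one_mul, integral_const_mul]
    exact ha.mul_right _

lemma tsum_coeffQ (ha : Summable fun k => ‖a k‖) {f g : Freq → ℝ}
    (hq : Integrable (fun t => f t * g t / (f t + g t)) haarAddCircle) :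
    ∑' l : ℕ, (∑' k : ℕ, coeffQ f g l k * a k) * starRingEnd ℂ (a l) =
      ((∫ t, ‖symbolA a t‖ ^ 2 * (f t * g t / (f t + g t)) ∂haarAddCircle : ℝ) : ℂ) := by
  set q : Freq → ℂ := fun t => ((f t * g t / (f t + g t) : ℝ) : ℂ) with hqdef
  have hqi : Integrable q haarAddCircle := hq.ofReal
  have h1 : ∀ l : ℕ, ∑' k : ℕ, coeffQ f g l k * a k =
      ∫ t, symbolA a t * (fourier (l : ℤ) t * q t) ∂haarAddCircle := by
    intro l
    rw [← (hasSum_integral_symbolA ha (integrable_fourier_mul hqi l)).tsum_eq]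
    refine tsum_congr fun k => ?_
    rw [coeffQ]
    congr 1
    refine integral_congr_ae (ae_of_all _ fun t => ?_)
    simp only [hqdef]
    rw [sub_eq_add_neg, fourier_add]
    ring
  have hconj : Integrable (fun t => starRingEnd ℂ (symbolA a t) * q t) haarAddCircle := by
    refine hqi.bdd_mul (c := ∑' k, ‖a k‖)
      (Complex.continuous_conj.comp (continuous_symbolA ha)).aestronglyMeasurable
      (ae_of_all _ fun t => ?_)
    rw [RCLike.norm_conj]
    exact norm_symbolA_le ha t
  -- The outer sum carries `conj (a l)`, so the exchange is applied to the conjugate symbol and then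
  -- conjugated.
  have h2 := (hasSum_integral_symbolA ha hconj).map (starRingEnd ℂ) Complex.continuous_conj
  simp_rw [h1]
  have h3 : ∀ l : ℕ, (∫ t, symbolA a t * (fourier (l : ℤ) t * q t) ∂haarAddCircle) *
      starRingEnd ℂ (a l) = (starRingEnd ℂ ∘ fun k : ℕ =>
        (∫ t, fourier (-(k : ℤ)) t * (starRingEnd ℂ (symbolA a t) * q t) ∂haarAddCircle) * a k) l := by
    intro l
    rw [Function.comp_apply, map_mul, ← integral_conj]
    congr 1
    refine integral_congr_ae (ae_of_all _ fun t => ?_)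
    simp only [hqdef, map_mul, fourier_neg, Complex.conj_conj, Complex.conj_ofReal]
    ring
  rw [tsum_congr h3, h2.tsum_eq, ← integral_conj, ← integral_complex_ofReal]
  refine integral_congr_ae (ae_of_all _ fun t => ?_)
  simp only [hqdef, map_mul, Complex.conj_conj, Complex.conj_ofReal]
  push_cast
  rw [← Complex.mul_conj']
  ring

end Symbol

/-! ### Decomposition of the mean-square error -/

section Pair

variable {a : ℕ → ℂ} {f g : Freq → ℝ}

lemma IsSpectralDensity.integrable_quot (hf : IsSpectralDensity f) (hg : IsSpectralDensity g) :
    Integrable (fun t => f t / (f t + g t)) haarAddCircle := by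
  refine Integrable.of_bound (C := 1)
    (hf.1.aemeasurable.div (hf.1.add hg.1).aemeasurable).aestronglyMeasurable ?_
  filter_upwards [hf.2, hg.2] with t h1 h2
  rw [Real.norm_of_nonneg (by positivity)]
  exact div_le_one_of_le₀ (by linarith) (by linarith)

lemma IsSpectralDensity.integrable_parallel (hf : IsSpectralDensity f) (hg : IsSpectralDensity g) :
    Integrable (fun t => f t * g t / (f t + g t)) haarAddCircle := by
  refine hg.1.mono ((hf.1.aemeasurable.mul hg.1.aemeasurable).div
    (hf.1.add hg.1).aemeasurable).aestronglyMeasurable ?_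
  filter_upwards [hf.2, hg.2] with t h1 h2
  rw [Real.norm_of_nonneg (by positivity), Real.norm_of_nonneg h2, mul_div_right_comm]
  exact mul_le_of_le_one_left h2 (div_le_one_of_le₀ (by linarith) (by linarith))

/-- Since `0 ≤ f/(f+g) ≤ 1`, the function `A f/(f+g)` is bounded, hence in `L₂(f+g)`; the isometry
carries it to `A f`. -/
lemma memLp_symbolA_mul (ha : Summable fun k => ‖a k‖) (hf : IsSpectralDensity f)
    (hg : IsSpectralDensity g) (W : RegularWeight fun t => f t + g t) :
    MemLp (fun t => symbolA a t * (f t : ℂ)) 2 (invWeight fun t => f t + g t) := by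
  have := W.isFiniteMeasure
  have h1 : MemLp (fun t => symbolA a t * ((f t / (f t + g t) : ℝ) : ℂ)) 2
      (weight fun t => f t + g t) := by
    refine MemLp.of_bound ?_ (∑' k, ‖a k‖) ?_
    · exact ((continuous_symbolA ha).aestronglyMeasurable.mul
        (Complex.continuous_ofReal.comp_aestronglyMeasurable (hf.integrable_quot hg).1)).mono_ac
          (weight_absolutelyContinuous _)
    · filter_upwards [(weight_absolutelyContinuous _).ae_le hf.2,
        (weight_absolutelyContinuous _).ae_le hg.2] with t h1 h2
      rw [norm_mul, Complex.norm_real, Real.norm_of_nonneg (by positivity)]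
      exact (mul_le_of_le_one_right (norm_nonneg _)
        (div_le_one_of_le₀ (by linarith) (by linarith))).trans (norm_symbolA_le ha t)
  refine (memLp_congr_ae ((weight_absolutelyContinuous _).ae_le ?_)).mp (W.memLp_mul h1)
  filter_upwards [W.pos] with t ht
  have : ((f t : ℂ) + g t) ≠ 0 := by exact_mod_cast ht.ne'
  push_cast
  field_simp

/-- Identifies the right-hand side of the system `P c = Ra` as the inner products of `A f` with the
exponentials, so that `P⁻¹Ra` becomes the projection of `A f`. -/
lemma vecRa_eq (ha : Summable fun k => ‖a k‖) (hf : IsSpectralDensity f)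
    (hg : IsSpectralDensity g) (W : RegularWeight fun t => f t + g t) :
    vecRa a f g = fun l => inner ℂ (W.expVec l) (memLp_symbolA_mul ha hf hg W).toLp := by
  ext l
  have hφ : Integrable (fun t : Freq => fourier (-((l : ℤ) + 1)) t *
      ((f t / (f t + g t) : ℝ) : ℂ)) haarAddCircle :=
    integrable_fourier_mul (hf.integrable_quot hg).ofReal _
  have h1 := (hasSum_integral_symbolA ha hφ).tsum_eq
  rw [RegularWeight.expVec, W.inner_toLp, vecRa]
  refine Eq.trans (tsum_congr fun m => ?_) (h1.trans (integral_congr_ae ?_))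
  · rw [coeffR]
    congr 1
    refine integral_congr_ae (ae_of_all _ fun t => ?_)
    simp only
    rw [← mul_assoc, ← fourier_add]
    push_cast
    rw [neg_add]
  · filter_upwards [W.pos] with t ht
    have : ((f t : ℂ) + g t) ≠ 0 := by exact_mod_cast ht.ne'
    rw [fourier_neg]
    push_cast
    field_simp

/-- Completing the square in `k`; the first term on the right does not involve the estimate. -/
lemma sq_error_identity (z k : ℂ) {x y : ℝ} (h : 0 < x + y) :
    x * ‖z - k‖ ^ 2 + y * ‖k‖ ^ 2 =
      ‖z‖ ^ 2 * (x * y / (x + y)) + 1 / (x + y) * ‖z * x - k * ((x + y : ℝ) : ℂ)‖ ^ 2 := by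
  simp only [← Complex.normSq_eq_norm_sq, Complex.normSq_apply, Complex.sub_re, Complex.sub_im,
    Complex.mul_re, Complex.mul_im, Complex.ofReal_re, Complex.ofReal_im]
  field_simp
  ring

lemma meanSquareError_eq (hf : IsSpectralDensity f) (hg : IsSpectralDensity g) (h : Freq → ℂ) :
    meanSquareError a h f g = ∫⁻ t, ENNReal.ofReal (f t) * ‖symbolA a t - h t‖ₑ ^ 2 ∂haarAddCircle +
      ∫⁻ t, ENNReal.ofReal (g t) * ‖h t‖ₑ ^ 2 ∂haarAddCircle := by
  rw [meanSquareError, lintegral_weight hf.1.aemeasurable, lintegral_weight hg.1.aemeasurable]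

lemma meanSquareError_eq_add (ha : Summable fun k => ‖a k‖) (hf : IsSpectralDensity f)
    (hg : IsSpectralDensity g) (W : RegularWeight fun t => f t + g t) {k : Freq → ℂ}
    (hk : AEStronglyMeasurable k haarAddCircle) :
    meanSquareError a k f g =
      ENNReal.ofReal (∫ t, ‖symbolA a t‖ ^ 2 * (f t * g t / (f t + g t)) ∂haarAddCircle) +
      ∫⁻ t, ‖symbolA a t * (f t : ℂ) - k t * ((f t + g t : ℝ) : ℂ)‖ₑ ^ 2
        ∂invWeight fun t => f t + g t := by
  have hint : Integrable (fun t => ‖symbolA a t‖ ^ 2 * (f t * g t / (f t + g t))) haarAddCircle := by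
    refine (hf.integrable_parallel hg).bdd_mul (c := (∑' k, ‖a k‖) ^ 2)
      ((continuous_symbolA ha).norm.pow 2).aestronglyMeasurable (ae_of_all _ fun t => ?_)
    rw [Real.norm_of_nonneg (by positivity)]
    have := norm_symbolA_le ha t
    gcongr
  have hnn : 0 ≤ᵐ[haarAddCircle] fun t => ‖symbolA a t‖ ^ 2 * (f t * g t / (f t + g t)) := by
    filter_upwards [hf.2, hg.2] with t h1 h2
    simp only [Pi.zero_apply]
    positivity
  have hmeas : AEMeasurable (fun t => ENNReal.ofReal (g t) * ‖k t‖ₑ ^ 2) haarAddCircle :=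
    hg.1.aemeasurable.ennreal_ofReal.mul (hk.enorm.pow_const 2)
  rw [meanSquareError_eq hf hg, ofReal_integral_eq_lintegral_ofReal hint hnn,
    lintegral_weight W.integrable_inv.aemeasurable,
    ← lintegral_add_left' hint.aemeasurable.ennreal_ofReal,
    ← lintegral_add_right' _ hmeas]
  refine lintegral_congr_ae ?_
  filter_upwards [W.pos, hf.2, hg.2] with t ht h1 h2
  have e := sq_error_identity (symbolA a t) (k t) ht
  simp only [← ofReal_norm]
  rw [← ENNReal.ofReal_pow (norm_nonneg _), ← ENNReal.ofReal_pow (norm_nonneg _),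
    ← ENNReal.ofReal_pow (norm_nonneg _), ← ENNReal.ofReal_mul h1, ← ENNReal.ofReal_mul h2,
    ← ENNReal.ofReal_mul (by positivity), ← ENNReal.ofReal_add (by positivity) (by positivity),
    ← ENNReal.ofReal_add (by positivity) (by positivity), e]

/-- The functions in `L₂(p)` without positive frequencies. -/
def HasNoFuture (p : Freq → ℝ) (h : Freq → ℂ) : Prop :=
  MemLp h 2 (weight p) ∧ ∀ l : ℕ, fourierCoeff h ((l : ℤ) + 1) = 0

lemma aestronglyMeasurable_seriesC (ha : Summable fun k => ‖a k‖) (hf : IsSpectralDensity f)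
    (hg : IsSpectralDensity g) (W : RegularWeight fun t => f t + g t) :
    AEStronglyMeasurable (seriesC a f g) haarAddCircle := by
  rw [seriesC, vecRa_eq ha hf hg W]
  exact (inverseSeries_spec W _).1.1.mono_ac W.haar_ac_inv

lemma aestronglyMeasurable_specChar (ha : Summable fun k => ‖a k‖) (hf : IsSpectralDensity f)
    (hg : IsSpectralDensity g) (W : RegularWeight fun t => f t + g t) :
    AEStronglyMeasurable (specChar a f g) haarAddCircle := by
  have h1 := aestronglyMeasurable_seriesC ha hf hg W
  have h2 : AEMeasurable (fun t => ((f t + g t : ℝ) : ℂ)) haarAddCircle :=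
    Complex.measurable_ofReal.comp_aemeasurable W.integrable.aemeasurable
  exact ((continuous_symbolA ha).aestronglyMeasurable.mul
    (Complex.continuous_ofReal.comp_aestronglyMeasurable (hf.integrable_quot hg).1)).sub
      (h1.aemeasurable.div h2).aestronglyMeasurable

lemma specChar_mul (W : RegularWeight fun t => f t + g t) :
    ∀ᵐ t ∂haarAddCircle, specChar a f g t * ((f t + g t : ℝ) : ℂ) =
      symbolA a t * (f t : ℂ) - seriesC a f g t := by
  filter_upwards [W.pos] with t ht
  have : ((f t : ℂ) + g t) ≠ 0 := by exact_mod_cast ht.ne'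
  rw [specChar]
  push_cast
  field_simp

lemma exists_seriesC_toLp (ha : Summable fun k => ‖a k‖) (hf : IsSpectralDensity f)
    (hg : IsSpectralDensity g) (W : RegularWeight fun t => f t + g t) :
    ∃ h : MemLp (seriesC a f g) 2 (invWeight fun t => f t + g t),
      h.toLp = W.futureSpace.starProjection (memLp_symbolA_mul ha hf hg W).toLp := by
  have h := inverseSeries_spec W (memLp_symbolA_mul ha hf hg W).toLp
  simp only [← vecRa_eq ha hf hg W] at h
  exact h

/-- After multiplication by `f + g` the spectral characteristic is `A f` minus its projection, hence
orthogonal to the future space. -/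
lemma hasNoFuture_specChar (ha : Summable fun k => ‖a k‖) (hf : IsSpectralDensity f)
    (hg : IsSpectralDensity g) (W : RegularWeight fun t => f t + g t) :
    HasNoFuture (fun t => f t + g t) (specChar a f g) := by
  obtain ⟨hC, hCeq⟩ := exists_seriesC_toLp ha hf hg W
  have hF := memLp_symbolA_mul ha hf hg W
  have hae := (weight_absolutelyContinuous fun t => 1 / (f t + g t)).ae_le
    (specChar_mul (a := a) W)
  have hmul : MemLp (fun t => specChar a f g t * ((f t + g t : ℝ) : ℂ)) 2
      (invWeight fun t => f t + g t) := (memLp_congr_ae hae).mpr (hF.sub hC)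
  have heq : hmul.toLp = hF.toLp - hC.toLp := by
    rw [← MemLp.toLp_sub]
    exact MemLp.toLp_congr _ _ hae
  refine ⟨W.memLp_of_memLp_mul (aestronglyMeasurable_specChar ha hf hg W) hmul, fun l => ?_⟩
  rw [← W.inner_expVec_mul hmul, heq, hCeq, ← inner_conj_symm,
    Submodule.starProjection_inner_eq_zero _ _ (W.expVec_mem l), map_zero]

lemma errorFunctional_eq (ha : Summable fun k => ‖a k‖) (hf : IsSpectralDensity f)
    (hg : IsSpectralDensity g) (W : RegularWeight fun t => f t + g t) :
    errorFunctional a f g =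
      ‖W.futureSpace.starProjection (memLp_symbolA_mul ha hf hg W).toLp‖ ^ 2 +
      ∫ t, ‖symbolA a t‖ ^ 2 * (f t * g t / (f t + g t)) ∂haarAddCircle := by
  rw [errorFunctional, tsum_coeffQ ha (hf.integrable_parallel hg), vecRa_eq ha hf hg W,
    inversePairing_eq, ← Complex.ofReal_add, Complex.ofReal_re]

/-- The error of an estimate without positive frequencies exceeds the value of the functional by
the squared distance to the spectral characteristic. -/
lemma meanSquareError_eq_errorFunctional_add (ha : Summable fun k => ‖a k‖)
    (hf : IsSpectralDensity f) (hg : IsSpectralDensity g) (W : RegularWeight fun t => f t + g t)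
    {k : Freq → ℂ} (hk : HasNoFuture (fun t => f t + g t) k) :
    meanSquareError a k f g = ENNReal.ofReal (errorFunctional a f g) +
      ∫⁻ t, ‖k t - specChar a f g t‖ₑ ^ 2 ∂weight fun t => f t + g t := by
  obtain ⟨hC, hCeq⟩ := exists_seriesC_toLp ha hf hg W
  have hF := memLp_symbolA_mul ha hf hg W
  have hkp := W.memLp_mul hk.1
  set K := W.futureSpace
  have horth : inner ℂ (K.starProjection hF.toLp)
      (hF.toLp - K.starProjection hF.toLp - hkp.toLp) = 0 := by
    rw [inner_sub_right, ← inner_conj_symm, Submodule.starProjection_inner_eq_zero _ _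
      (Submodule.starProjection_apply_mem _ _), map_zero, zero_sub, neg_eq_zero]
    refine (Submodule.mem_orthogonal _ _).mp (W.mem_orthogonal_futureSpace fun l => ?_) _
      (Submodule.starProjection_apply_mem _ _)
    rw [W.inner_expVec_mul, hk.2 l]
  -- `A f - k(f+g)` splits into the projection of `A f`, in the future space, and a remainder
  -- orthogonal to it. The remainder is `(h(f,g) - k)(f+g)`, which `hdist` measures.
  have hpyth : ‖hF.toLp - hkp.toLp‖ ^ 2 = ‖K.starProjection hF.toLp‖ ^ 2 +
      ‖hF.toLp - K.starProjection hF.toLp - hkp.toLp‖ ^ 2 := by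
    have := norm_add_sq_eq_norm_sq_add_norm_sq_of_inner_eq_zero _ _ horth
    rw [pow_two, pow_two, pow_two, ← this]
    congr 2 <;> abel_nf
  have hdist : ∫⁻ t, ‖k t - specChar a f g t‖ₑ ^ 2 ∂(weight fun t => f t + g t) =
      ENNReal.ofReal (‖hF.toLp - K.starProjection hF.toLp - hkp.toLp‖ ^ 2) := by
    rw [← hCeq, ← MemLp.toLp_sub, ← MemLp.toLp_sub, ← lintegral_enorm_sq_eq,
      ← W.lintegral_mul_inv]
    refine lintegral_congr_ae ((weight_absolutelyContinuous _).ae_le ?_)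
    filter_upwards [specChar_mul (a := a) W] with t ht
    rw [sub_mul, ht, ← enorm_neg]
    simp [Pi.sub_apply]
  rw [meanSquareError_eq_add ha hf hg W (hk.1.1.mono_ac W.haar_ac), hdist,
    errorFunctional_eq ha hf hg W]
  have h1 : ∫⁻ t, ‖symbolA a t * (f t : ℂ) - k t * ((f t + g t : ℝ) : ℂ)‖ₑ ^ 2
        ∂(invWeight fun t => f t + g t) = ENNReal.ofReal (‖hF.toLp - hkp.toLp‖ ^ 2) := by
    rw [← MemLp.toLp_sub, ← lintegral_enorm_sq_eq]
    rfl
  have hQ : 0 ≤ ∫ t, ‖symbolA a t‖ ^ 2 * (f t * g t / (f t + g t)) ∂haarAddCircle := by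
    refine integral_nonneg_of_ae ?_
    filter_upwards [hf.2, hg.2] with t h1 h2
    simp only [Pi.zero_apply]
    positivity
  rw [h1, hpyth, ← ENNReal.ofReal_add hQ (by positivity),
    ← ENNReal.ofReal_add (by positivity) (by positivity)]
  congr 1
  ring

end Pair

/-! ### Optimality of the spectral characteristic -/

lemma fourierCoeff_past_finsupp (x : ℕ →₀ ℂ) (l : ℕ) :
    fourierCoeff (fun t : Freq => x.sum fun m z => z * (fourier (-(m : ℤ)) t : ℂ)) ((l : ℤ) + 1) =
      0 := by
  have h : ∀ t : Freq, (fourier (-((l : ℤ) + 1)) t : ℂ) •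
      (x.sum fun m z => z * (fourier (-(m : ℤ)) t : ℂ)) =
      ∑ m ∈ x.support, x m * (fourier (-((l : ℤ) + 1) + -(m : ℤ)) t : ℂ) := by
    intro t
    rw [Finsupp.sum, smul_eq_mul, Finset.mul_sum]
    refine Finset.sum_congr rfl fun m _ => ?_
    rw [fourier_add]
    ring
  simp_rw [fourierCoeff, h]
  rw [integral_finsetSum _ fun m _ =>
    memLp_one_iff_integrable.mp (memLp_const_mul_fourier haarAddCircle 1 _ _)]
  refine Finset.sum_eq_zero fun m _ => ?_
  rw [integral_const_mul, integral_fourier_eq_ite, if_neg (by omega), mul_zero]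

/-- By Cauchy–Schwarz, with `1/p` integrable, each Fourier coefficient is continuous on `L₂(p)`. The
positive ones vanish on the spanning exponentials, hence on the closure. -/
lemma InPastSpace.hasNoFuture {p : Freq → ℝ} (W : RegularWeight p) {k : Freq → ℂ}
    (hk : InPastSpace p k) : HasNoFuture p k := by
  have := W.isFiniteMeasure
  refine ⟨hk.1, fun l => ?_⟩
  have hbound : ∀ r : ℝ, 0 < r → ‖fourierCoeff k ((l : ℤ) + 1)‖ ≤ ‖W.expVec l‖ * r := by
    intro r hr
    obtain ⟨x, hx⟩ := hk.2 (ENNReal.ofReal r) (by simpa using hr)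
    have hP : MemLp (fun t => x.sum fun m z => z * (fourier (-(m : ℤ)) t : ℂ)) 2 (weight p) :=
      memLp_finsetSum _ fun _ _ => memLp_const_mul_fourier _ 2 _ _
    have hd := W.memLp_mul (hk.1.sub hP)
    have hnorm : ‖hd.toLp‖ ≤ r := by
      have h1 := lintegral_enorm_sq_eq hd
      rw [W.lintegral_mul_inv, ← eLpNorm_two_sq] at h1
      have h2 : ENNReal.ofReal (‖hd.toLp‖ ^ 2) ≤ ENNReal.ofReal (r ^ 2) := by
        rw [← h1, ENNReal.ofReal_pow hr.le]
        exact pow_le_pow_left' hx.le 2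
      rw [ENNReal.ofReal_le_ofReal_iff (by positivity)] at h2
      exact le_of_sq_le_sq h2 hr.le
    have hsub : hd.toLp = (W.memLp_mul hk.1).toLp - (W.memLp_mul hP).toLp := by
      rw [← MemLp.toLp_sub]
      refine MemLp.toLp_congr _ _ (ae_of_all _ fun t => ?_)
      simp [sub_mul]
    have heq : inner ℂ (W.expVec l) hd.toLp = fourierCoeff k ((l : ℤ) + 1) := by
      rw [hsub, inner_sub_right, W.inner_expVec_mul, W.inner_expVec_mul,
        fourierCoeff_past_finsupp, sub_zero]
    rw [← heq]
    exact (norm_inner_le_norm _ _).trans (by gcongr)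
  have hlim : Tendsto (fun n : ℕ => ‖W.expVec l‖ * (1 / ((n : ℝ) + 1))) atTop (𝓝 0) := by
    simpa using tendsto_one_div_add_atTop_nhds_zero_nat.const_mul ‖W.expVec l‖
  exact norm_le_zero_iff.mp (ge_of_tendsto' hlim fun n => hbound _ (by positivity))

section Pair

variable {a : ℕ → ℂ} {f g : Freq → ℝ}

lemma meanSquareError_specChar (ha : Summable fun k => ‖a k‖)
    (hf : IsSpectralDensity f) (hg : IsSpectralDensity g) (W : RegularWeight fun t => f t + g t) :
    meanSquareError a (specChar a f g) f g = ENNReal.ofReal (errorFunctional a f g) := by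
  simp [meanSquareError_eq_errorFunctional_add ha hf hg W (hasNoFuture_specChar ha hf hg W)]

lemma norm_specChar (W : RegularWeight fun t => f t + g t) :
    ∀ᵐ t ∂haarAddCircle, ‖specChar a f g t‖ = RobustFiltering.hg a f g t := by
  filter_upwards [specChar_mul (a := a) W, W.pos] with t h1 h2
  rw [RobustFiltering.hg, ← h1, norm_mul, Complex.norm_real, Real.norm_of_nonneg h2.le]
  field_simp

/-- The weight `p` is arbitrary and unrelated to `(f, g)`: boundedness of `h_g` gives membership in
all the past spaces at once. -/
lemma inPastSpace_specChar (ha : Summable fun k => ‖a k‖) (hf : IsSpectralDensity f)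
    (hg : IsSpectralDensity g) (W : RegularWeight fun t => f t + g t)
    (hbdd : ∃ M : ℝ, ∀ᵐ t ∂haarAddCircle, RobustFiltering.hg a f g t ≤ M) {p : Freq → ℝ}
    (hp : Integrable p haarAddCircle) : InPastSpace p (specChar a f g) := by
  obtain ⟨M, hM⟩ := hbdd
  refine inPastSpace_of_bounded (M := M) hp (aestronglyMeasurable_specChar ha hf hg W) ?_
    (hasNoFuture_specChar ha hf hg W).2
  filter_upwards [norm_specChar (a := a) W, hM] with t h1 h2
  rwa [h1]

lemma ofReal_errorFunctional_le_meanSquareError (ha : Summable fun k => ‖a k‖)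
    (hf : IsSpectralDensity f) (hg : IsSpectralDensity g) (W : RegularWeight fun t => f t + g t)
    {h : Freq → ℂ} (hh : InPastSpace (fun t => f t + g t) h) :
    ENNReal.ofReal (errorFunctional a f g) ≤ meanSquareError a h f g := by
  rw [meanSquareError_eq_errorFunctional_add ha hf hg W (hh.hasNoFuture W)]
  exact le_self_add

lemma ofReal_errorFunctional_le_optimalError (ha : Summable fun k => ‖a k‖)
    (hf : IsSpectralDensity f) (hg : IsSpectralDensity g) (W : RegularWeight fun t => f t + g t) :
    ENNReal.ofReal (errorFunctional a f g) ≤ optimalError a f g :=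
  le_iInf₂ fun _ hh => ofReal_errorFunctional_le_meanSquareError ha hf hg W hh

end Pair

/-! ### The saddle point inequality

Maximality of the functional along the segments `(1 - s) g₀ + s g` already yields the saddle point
inequality at the spectral characteristic of `(f, g₀)`, by letting `s → 0`. -/

section Saddle

variable {a : ℕ → ℂ} {f g₀ g : Freq → ℝ}

/-- The density `(1 - s) g₀ + s g`. -/
def mixDensity (s : ℝ) (g₀ g : Freq → ℝ) (t : Freq) : ℝ := (1 - s) * g₀ t + s * g t

lemma IsSpectralDensity.mix {s : ℝ} (h0 : 0 ≤ s) (h1 : s ≤ 1) (hg₀ : IsSpectralDensity g₀)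
    (hg : IsSpectralDensity g) : IsSpectralDensity (mixDensity s g₀ g) := by
  refine ⟨(hg₀.1.const_mul _).add (hg.1.const_mul _), ?_⟩
  filter_upwards [hg₀.2, hg.2] with t h2 h3
  have : 0 ≤ 1 - s := by linarith
  rw [mixDensity]
  positivity

lemma mixDensity_mem_contaminatedClass {ε P₂ s : ℝ} {g₁ : Freq → ℝ} (h0 : 0 ≤ s) (h1 : s ≤ 1)
    (hg₀ : g₀ ∈ contaminatedClass ε g₁ P₂) (hg : g ∈ contaminatedClass ε g₁ P₂) :
    mixDensity s g₀ g ∈ contaminatedClass ε g₁ P₂ := by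
  obtain ⟨hd₀, ⟨w₀, hw₀, he₀⟩, hP₀⟩ := hg₀
  obtain ⟨hd, ⟨w, hw, he⟩, hP⟩ := hg
  refine ⟨hd₀.mix h0 h1 hd, ⟨_, hw₀.mix h0 h1 hw, ?_⟩, ?_⟩
  · filter_upwards [he₀, he] with t h2 h3
    simp only [mixDensity, h2, h3]
    ring
  · simp only [mixDensity]
    rw [integral_add (hd₀.1.const_mul _) (hd.1.const_mul _), integral_const_mul,
      integral_const_mul]
    nlinarith

lemma add_mixDensity_ge {s : ℝ} (h0 : 0 ≤ s) (hf : IsSpectralDensity f)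
    (hg : IsSpectralDensity g) :
    ∀ᵐ t ∂haarAddCircle, (1 - s) * (f t + g₀ t) ≤ f t + mixDensity s g₀ g t := by
  filter_upwards [hf.2, hg.2] with t h2 h3
  rw [mixDensity]
  nlinarith [mul_nonneg h0 h2, mul_nonneg h0 h3]

/-- The mixture keeps at least `(1 - s)(f + g₀)`, so minimality is inherited from `g₀` alone; this
is why `s = 1` is excluded. -/
lemma Minimality.mix {s : ℝ} (h0 : 0 ≤ s) (h1 : s < 1) (hf : IsSpectralDensity f)
    (hg : IsSpectralDensity g) (hmin : Minimality f g₀) : Minimality f (mixDensity s g₀ g) := by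
  have hs : 0 < 1 - s := by linarith
  have hne : (ENNReal.ofReal (1 - s))⁻¹ ≠ ⊤ := by simpa using hs
  refine lt_of_le_of_lt (lintegral_mono_ae ?_)
    ((lintegral_const_mul' (ENNReal.ofReal (1 - s))⁻¹ _ hne).trans_lt
      (ENNReal.mul_lt_top hne.lt_top hmin))
  filter_upwards [add_mixDensity_ge (g₀ := g₀) h0 hf hg] with t ht
  rw [← ENNReal.mul_inv (Or.inl (by simpa using hs)) (Or.inl ENNReal.ofReal_ne_top),
    ← ENNReal.ofReal_mul hs.le]
  exact ENNReal.inv_le_inv.mpr (ENNReal.ofReal_le_ofReal ht)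

lemma weight_le_smul {c : ℝ} (hc : 0 ≤ c) {p q : Freq → ℝ}
    (h : ∀ᵐ t ∂haarAddCircle, p t ≤ c * q t) : weight p ≤ ENNReal.ofReal c • weight q := by
  rw [weight, weight, ← withDensity_smul' _ _ ENNReal.ofReal_ne_top]
  refine withDensity_mono ?_
  filter_upwards [h] with t ht
  simp only [Pi.smul_apply, smul_eq_mul]
  rw [← ENNReal.ofReal_mul hc]
  exact ENNReal.ofReal_le_ofReal ht

/-- `f + g₀` is at most `1/(1 - s)` times the mixed weight, and Fourier coefficients do not depend
on the weight. Thus the estimate optimal for the mixture can be tested in the error decomposition at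
`g₀`. -/
lemma HasNoFuture.of_mix {s : ℝ} (h0 : 0 ≤ s) (h1 : s < 1) (hf : IsSpectralDensity f)
    (hg : IsSpectralDensity g) {h : Freq → ℂ}
    (hh : HasNoFuture (fun t => f t + mixDensity s g₀ g t) h) :
    HasNoFuture (fun t => f t + g₀ t) h := by
  have hs : 0 < 1 - s := by linarith
  refine ⟨hh.1.of_measure_le_smul (c := ENNReal.ofReal (1 / (1 - s))) ENNReal.ofReal_ne_top
    (weight_le_smul (by positivity) ?_), hh.2⟩
  filter_upwards [add_mixDensity_ge (g₀ := g₀) h0 hf hg] with t ht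
  rw [one_div, ← div_eq_inv_mul, le_div_iff₀ hs]
  linarith

lemma meanSquareError_mix {s : ℝ} (h0 : 0 ≤ s) (h1 : s ≤ 1) (hf : IsSpectralDensity f)
    (hg₀ : IsSpectralDensity g₀) (hg : IsSpectralDensity g) {h : Freq → ℂ}
    (hh : AEStronglyMeasurable h haarAddCircle) :
    meanSquareError a h f (mixDensity s g₀ g) =
      ENNReal.ofReal (1 - s) * meanSquareError a h f g₀ +
        ENNReal.ofReal s * meanSquareError a h f g := by
  have hs : 0 ≤ 1 - s := by linarith
  have hone : ENNReal.ofReal (1 - s) + ENNReal.ofReal s = 1 := by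
    rw [← ENNReal.ofReal_add hs h0, sub_add_cancel, ENNReal.ofReal_one]
  have hmeas : AEMeasurable (fun t => ENNReal.ofReal s * (ENNReal.ofReal (g t) * ‖h t‖ₑ ^ 2))
      haarAddCircle :=
    (hg.1.aemeasurable.ennreal_ofReal.mul (hh.enorm.pow_const 2)).const_mul _
  have hint : ∫⁻ t, ENNReal.ofReal (mixDensity s g₀ g t) * ‖h t‖ₑ ^ 2 ∂haarAddCircle =
      ENNReal.ofReal (1 - s) * (∫⁻ t, ENNReal.ofReal (g₀ t) * ‖h t‖ₑ ^ 2 ∂haarAddCircle) +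
        ENNReal.ofReal s * ∫⁻ t, ENNReal.ofReal (g t) * ‖h t‖ₑ ^ 2 ∂haarAddCircle := by
    rw [← lintegral_const_mul' _ _ ENNReal.ofReal_ne_top,
      ← lintegral_const_mul' _ _ ENNReal.ofReal_ne_top, ← lintegral_add_right' _ hmeas]
    refine lintegral_congr_ae ?_
    filter_upwards [hg₀.2, hg.2] with t h2 h3
    rw [mixDensity, ENNReal.ofReal_add (by positivity) (by positivity), ENNReal.ofReal_mul hs,
      ENNReal.ofReal_mul h0]
    ring
  rw [meanSquareError_eq hf (hg₀.mix h0 h1 hg), meanSquareError_eq hf hg₀,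
    meanSquareError_eq hf hg, hint]
  set X := ∫⁻ t, ENNReal.ofReal (f t) * ‖symbolA a t - h t‖ₑ ^ 2 ∂haarAddCircle
  conv_lhs => rw [← one_mul X, ← hone]
  ring

/-- The density of the mean-square error. -/
def errorDensity (a : ℕ → ℂ) (f g : Freq → ℝ) (h : Freq → ℂ) (t : Freq) : ENNReal :=
  ENNReal.ofReal (f t) * ‖symbolA a t - h t‖ₑ ^ 2 + ENNReal.ofReal (g t) * ‖h t‖ₑ ^ 2

lemma aemeasurable_errorDensity (ha : Summable fun k => ‖a k‖) (hf : IsSpectralDensity f)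
    (hg : IsSpectralDensity g) {h : Freq → ℂ} (hh : AEStronglyMeasurable h haarAddCircle) :
    AEMeasurable (errorDensity a f g h) haarAddCircle := by
  have h1 : AEMeasurable (fun t => ‖symbolA a t - h t‖ₑ ^ 2) haarAddCircle :=
    ((continuous_symbolA ha).aestronglyMeasurable.sub hh).enorm.pow_const 2
  exact (hf.1.aemeasurable.ennreal_ofReal.mul h1).add
    (hg.1.aemeasurable.ennreal_ofReal.mul (hh.enorm.pow_const 2))

lemma meanSquareError_eq_lintegral (hf : IsSpectralDensity f) (hg : IsSpectralDensity g)
    {h : Freq → ℂ} (hh : AEStronglyMeasurable h haarAddCircle) :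
    meanSquareError a h f g = ∫⁻ t, errorDensity a f g h t ∂haarAddCircle := by
  have hmeas : AEMeasurable (fun t => ENNReal.ofReal (g t) * ‖h t‖ₑ ^ 2) haarAddCircle :=
    hg.1.aemeasurable.ennreal_ofReal.mul (hh.enorm.pow_const 2)
  rw [meanSquareError_eq hf hg, ← lintegral_add_right' _ hmeas]
  rfl

lemma tendsto_errorDensity {h : ℕ → Freq → ℂ} {h₀ : Freq → ℂ} {t : Freq}
    (ht : Tendsto (fun n => h n t) atTop (𝓝 (h₀ t))) :
    Tendsto (fun n => errorDensity a f g (h n) t) atTop (𝓝 (errorDensity a f g h₀ t)) := by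
  have h1 : Tendsto (fun n => ‖symbolA a t - h n t‖ₑ ^ 2) atTop
      (𝓝 (‖symbolA a t - h₀ t‖ₑ ^ 2)) :=
    ENNReal.Tendsto.pow (tendsto_const_nhds.sub ht).enorm
  have h2 : Tendsto (fun n => ‖h n t‖ₑ ^ 2) atTop (𝓝 (‖h₀ t‖ₑ ^ 2)) :=
    ENNReal.Tendsto.pow ht.enorm
  exact (ENNReal.Tendsto.const_mul h1 (Or.inr ENNReal.ofReal_ne_top)).add
    (ENNReal.Tendsto.const_mul h2 (Or.inr ENNReal.ofReal_ne_top))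

/-- The error is lower semicontinuous along almost everywhere convergent estimates. -/
lemma meanSquareError_le_of_tendsto (ha : Summable fun k => ‖a k‖) (hf : IsSpectralDensity f)
    (hg : IsSpectralDensity g) {h : ℕ → Freq → ℂ} {h₀ : Freq → ℂ}
    (hm : ∀ n, AEStronglyMeasurable (h n) haarAddCircle)
    (hlim : ∀ᵐ t ∂haarAddCircle, Tendsto (fun n => h n t) atTop (𝓝 (h₀ t))) {B : ENNReal}
    (hB : ∀ n, meanSquareError a (h n) f g ≤ B) : meanSquareError a h₀ f g ≤ B := by
  have hm₀ : AEStronglyMeasurable h₀ haarAddCircle :=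
    aestronglyMeasurable_of_tendsto_ae atTop hm hlim
  have heq : ∫⁻ t, errorDensity a f g h₀ t ∂haarAddCircle =
      ∫⁻ t, liminf (fun n => errorDensity a f g (h n) t) atTop ∂haarAddCircle := by
    refine lintegral_congr_ae ?_
    filter_upwards [hlim] with t ht
    exact (tendsto_errorDensity ht).liminf_eq.symm
  rw [meanSquareError_eq_lintegral hf hg hm₀, heq]
  refine (lintegral_liminf_le' fun n => aemeasurable_errorDensity ha hf hg (hm n)).trans
    (liminf_le_of_frequently_le' (Frequently.of_forall fun n => ?_))
  rw [← meanSquareError_eq_lintegral hf hg (hm n)]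
  exact hB n

/-- For `s ∈ (0, 1/2]`, if the functional at `(1 - s) g₀ + s g` does not exceed its value at `g₀`,
then the spectral characteristic of the mixture has a controlled error under `g` and is close to
that of `g₀`. -/
lemma specChar_mix_bounds {s : ℝ} (h0 : 0 < s) (h1 : s ≤ 1 / 2) (ha : Summable fun k => ‖a k‖)
    (hf : IsSpectralDensity f) (hg₀ : IsSpectralDensity g₀) (hg : IsSpectralDensity g)
    (hmin : Minimality f g₀)
    (hle : errorFunctional a f (mixDensity s g₀ g) ≤ errorFunctional a f g₀) :
    meanSquareError a (specChar a f (mixDensity s g₀ g)) f g ≤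
        ENNReal.ofReal (errorFunctional a f g₀) ∧
      ∫⁻ t, ‖specChar a f (mixDensity s g₀ g) t - specChar a f g₀ t‖ₑ ^ 2
          ∂(weight fun t => f t + g₀ t) ≤
        ENNReal.ofReal (2 * s) * ENNReal.ofReal (errorFunctional a f g₀) := by
  have hs1 : s < 1 := by linarith
  have hs : 0 ≤ 1 - s := by linarith
  have hgs := hg₀.mix h0.le hs1.le hg
  have W₀ := hmin.regularWeight hf hg₀
  have Ws := (hmin.mix h0.le hs1 hf hg).regularWeight hf hgs
  -- The error of `h_s` at the mixture is computed twice: by optimality it is `Φ(g_s)`, and by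
  -- affinity it is `(1 - s)(D + Z) + s Y`.
  have key := meanSquareError_mix (a := a) h0.le hs1.le hf hg₀ hg
    (aestronglyMeasurable_specChar ha hf hgs Ws)
  rw [meanSquareError_specChar ha hf hgs Ws, meanSquareError_eq_errorFunctional_add ha hf hg₀ W₀
    ((hasNoFuture_specChar ha hf hgs Ws).of_mix h0.le hs1 hf hg)] at key
  set D := ENNReal.ofReal (errorFunctional a f g₀) with hD
  set Y := meanSquareError a (specChar a f (mixDensity s g₀ g)) f g
  set Z := ∫⁻ t, ‖specChar a f (mixDensity s g₀ g) t - specChar a f g₀ t‖ₑ ^ 2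
          ∂(weight fun t => f t + g₀ t)
  have hone : ENNReal.ofReal (1 - s) * D + ENNReal.ofReal s * D = D := by
    rw [← add_mul, ← ENNReal.ofReal_add hs h0.le, sub_add_cancel, ENNReal.ofReal_one, one_mul]
  have hDtop : ENNReal.ofReal (1 - s) * D ≠ ⊤ :=
    ENNReal.mul_ne_top ENNReal.ofReal_ne_top ENNReal.ofReal_ne_top
  -- Maximality bounds the total by `D = (1 - s) D + s D`; the finite term `(1 - s) D` cancels.
  have h2 : ENNReal.ofReal (1 - s) * Z + ENNReal.ofReal s * Y ≤ ENNReal.ofReal s * D := by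
    refine (ENNReal.add_le_add_iff_left hDtop).mp ?_
    rw [hone, ← add_assoc, ← mul_add, ← key]
    exact ENNReal.ofReal_le_ofReal hle
  constructor
  · exact (ENNReal.mul_le_mul_iff_right (by simpa using h0) ENNReal.ofReal_ne_top).mp
      (le_add_self.trans h2)
  -- The constant `2` comes from `1 - s ≥ 1/2`.
  · calc Z = ENNReal.ofReal 2 * (ENNReal.ofReal (1 / 2) * Z) := by
          rw [← mul_assoc, ← ENNReal.ofReal_mul (by norm_num)]
          norm_num
      _ ≤ ENNReal.ofReal 2 * (ENNReal.ofReal (1 - s) * Z) := by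
          gcongr
          linarith
      _ ≤ ENNReal.ofReal 2 * (ENNReal.ofReal s * D) := by
          exact mul_le_mul' le_rfl (le_self_add.trans h2)
      _ = _ := by rw [← mul_assoc, ← ENNReal.ofReal_mul (by norm_num)]

/-- If `g₀` maximizes the functional along all segments towards `g`, the spectral characteristic of
`(f, g₀)` has no larger error under `g` than under `g₀`. -/
lemma meanSquareError_specChar_le (ha : Summable fun k => ‖a k‖)
    (hf : IsSpectralDensity f) (hg₀ : IsSpectralDensity g₀) (hg : IsSpectralDensity g)
    (hmin : Minimality f g₀)
    (hmax : ∀ s : ℝ, 0 < s → s < 1 →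
      errorFunctional a f (mixDensity s g₀ g) ≤ errorFunctional a f g₀) :
    meanSquareError a (specChar a f g₀) f g ≤ ENNReal.ofReal (errorFunctional a f g₀) := by
  set s : ℕ → ℝ := fun n => 1 / 2 * (1 / ((n : ℝ) + 1)) with hsdef
  have hs0 : ∀ n, 0 < s n := fun n => by positivity
  have hs1 : ∀ n, s n ≤ 1 / 2 := fun n =>
    mul_le_of_le_one_right (by norm_num) (div_le_one_of_le₀ (by linarith [n.cast_nonneg (α := ℝ)])
      (by positivity))
  have hslim : Tendsto s atTop (𝓝 0) := by
    simpa [hsdef] using tendsto_one_div_add_atTop_nhds_zero_nat.const_mul (1 / 2 : ℝ)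
  have W₀ := hmin.regularWeight hf hg₀
  have hs1' : ∀ n, s n < 1 := fun n => by linarith [hs1 n]
  have hbounds := fun n => specChar_mix_bounds (hs0 n) (hs1 n) ha hf hg₀ hg hmin
    (hmax _ (hs0 n) (hs1' n))
  have hmeas : ∀ n, AEStronglyMeasurable (specChar a f (mixDensity (s n) g₀ g)) haarAddCircle :=
    fun n => aestronglyMeasurable_specChar ha hf (hg₀.mix (hs0 n).le (hs1' n).le hg)
      ((hmin.mix (hs0 n).le (hs1' n) hf hg).regularWeight hf
        (hg₀.mix (hs0 n).le (hs1' n).le hg))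
  have hac := weight_absolutelyContinuous fun t => f t + g₀ t
  have hlim0 : Tendsto (fun n => ENNReal.ofReal (2 * s n) *
      ENNReal.ofReal (errorFunctional a f g₀)) atTop (𝓝 0) := by
    have h1 : Tendsto (fun n => ENNReal.ofReal (2 * s n)) atTop (𝓝 0) := by
      simpa using ENNReal.tendsto_ofReal (hslim.const_mul 2)
    simpa using ENNReal.Tendsto.mul_const h1 (Or.inr ENNReal.ofReal_ne_top)
  have hL2 : Tendsto (fun n => eLpNorm (specChar a f (mixDensity (s n) g₀ g) - specChar a f g₀) 2
      (weight fun t => f t + g₀ t)) atTop (𝓝 0) := by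
    rw [ENNReal.tendsto_nhds_zero]
    intro δ hδ
    filter_upwards [hlim0.eventually_lt_const (u := δ ^ 2) (by positivity)] with n hn
    have h1 := ((hbounds n).2.trans_lt hn)
    refine le_of_not_ge fun hle => ?_
    rw [← eLpNorm_two_sq (weight fun t => f t + g₀ t)
      (fun t => specChar a f (mixDensity (s n) g₀ g) t - specChar a f g₀ t)] at h1
    exact h1.not_ge (pow_le_pow_left' hle 2)
  -- Convergence in `L₂(f + g₀)` gives an a.e. convergent subsequence. As `f + g₀ > 0` a.e., the
  -- null sets are those of Haar measure, so Fatou's lemma applies under `g` as well.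
  obtain ⟨ns, -, hns⟩ := (tendstoInMeasure_of_tendsto_eLpNorm two_ne_zero
    (fun n => (hmeas n).mono_ac hac)
    ((aestronglyMeasurable_specChar ha hf hg₀ W₀).mono_ac hac) hL2).exists_seq_tendsto_ae
  exact meanSquareError_le_of_tendsto ha hf hg (fun n => hmeas (ns n))
    (W₀.haar_ac.ae_le hns) fun n => (hbounds (ns n)).1

end Saddle

end RobustFiltering

end

/-! ### From the saddle point to both conclusions -/

theorem mainTheorem10
    (a : ℕ → ℂ)
    (ha₁ : Summable fun k => ‖a k‖)
    (ha₂ : Summable fun k : ℕ => ((k : ℝ) + 1) * ‖a k‖ ^ 2)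
    (ε P₂ : ℝ) (hε : 0 ≤ ε ∧ ε ≤ 1)
    (f g₁ g₀ : Freq → ℝ)
    (hf : IsSpectralDensity f)
    (hg₁ : IsSpectralDensity g₁)
    (hg₀ : g₀ ∈ contaminatedClass ε g₁ P₂)
    (hmin : Minimality f g₀)
    (hbdd : ∃ M : ℝ, ∀ᵐ t ∂AddCircle.haarAddCircle, hg a f g₀ t ≤ M)
    (α₂ : ℝ)
    (hform : ∀ᵐ t ∂AddCircle.haarAddCircle,
      g₀ t = max ((1 - ε) * g₁ t)
        (α₂ * ‖symbolA a t * (f t : ℂ) - seriesC a f g₀ t‖ - f t))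
    (hsol : SolvesExtremalProblem a {f} (contaminatedClass ε g₁ P₂) f g₀) :
    LeastFavorable a {f} (contaminatedClass ε g₁ P₂) f g₀ ∧
      MinimaxRobust a {f} (contaminatedClass ε g₁ P₂) (specChar a f g₀) := by
  have hd₀ : IsSpectralDensity g₀ := hg₀.1
  have W := hmin.regularWeight hf hd₀
  have hpast : ∀ g ∈ contaminatedClass ε g₁ P₂,
      InPastSpace (fun t => f t + g t) (specChar a f g₀) := fun g hg =>
    inPastSpace_specChar ha₁ hf hd₀ W hbdd (hf.1.add hg.1.1)
  have hsaddle : ∀ g ∈ contaminatedClass ε g₁ P₂,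
      meanSquareError a (specChar a f g₀) f g ≤ ENNReal.ofReal (errorFunctional a f g₀) :=
    -- The class is convex and minimality holds on the half-open segment from `g₀`, so every mixture
    -- with `0 < s < 1` competes in the extremal problem.
    fun g hg => meanSquareError_specChar_le ha₁ hf hd₀ hg.1 hmin fun s h0 h1 =>
      hsol.2.2.2 f rfl _ (mixDensity_mem_contaminatedClass h0.le h1.le hg₀ hg)
        (hmin.mix h0.le h1 hf hg.1)
  refine ⟨⟨rfl, hg₀, ?_⟩, ?_, fun h hh => ?_⟩
  · rintro _ rfl g hg
    exact (iInf₂_le _ (hpast g hg)).trans ((hsaddle g hg).trans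
      (ofReal_errorFunctional_le_optimalError ha₁ hf hd₀ W))
  · rintro _ rfl g hg
    exact hpast g hg
  · refine le_trans (b := ENNReal.ofReal (errorFunctional a f g₀)) ?_ ?_
    · refine iSup₂_le fun f' hf' => iSup₂_le fun g hg => ?_
      rw [Set.mem_singleton_iff.mp hf']
      exact hsaddle g hg
    -- The worst-case error of any admissible estimate is at least its error at `g₀`, which is
    -- bounded below by `Φ(g₀)`.
    · refine (ofReal_errorFunctional_le_meanSquareError ha₁ hf hd₀ W (hh f rfl g₀ hg₀)).trans ?_
      exact le_iSup₂_of_le f rfl (le_iSup₂_of_le g₀ hg₀ le_rfl)
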